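/- Let $(\overline M,J,\overline g)$ be a locally conformal Kähler manifold: a smooth almost Hermitian manifold such that every point has an open neighbourhood $U$ and a smooth function $f_U:U\to\mathbb R$ for which $(U,J,e^{-f_U}\overline g)$ is Kähler. Let $\omega$ be its Lee form (the global $1$-form with $\omega|_U=df_U$ for such local functions $f_U$ on neighbourhoods of all points) and let $B=\omega^\sharp$ be the Lee vector field, $\overline g(X,B)=\omega(X)$. Let $M$ be an (immersed) CR-submanifold of $\overline M$, i.e. there is a smooth distribution $D$ on $M$ with $JD_p=D_p$ for all $p\in M$, whose orthogonal complement $D^\perp$ in $TM$ satisfies $JD^\perp_p\subset T_p^\perp M$ for all $p\in M$. Suppose that $B$ is normal to $M$ at every point of $M$, and that $M$ is totally geodesic in $(\overline M,\overline g)$, i.e. its second fundamental form vanishes. Then $M$ is a totally real ruled CR-submanifold: the distribution $D^\perp$ is integrable (through every point of $M$ passes an integral manifold of $D^\perp$, so that $D^\perp$ is tangent to a foliation $\mathfrak F^\perp$ of $M$), and the integral manifolds of $D^\perp$, in particular all leaves of $\mathfrak F^\perp$, are totally geodesic immersed in $(\overline M,\overline g)$. -/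

import Mathlib

open Bundle Set
open scoped Manifold ContDiff

noncomputable section

namespace LCK

universe u v

/-! ### Riemannian geometry in charts

Manifolds are smooth, finite dimensional and without boundary, modelled on a normed space `E`.
In Mathlib the tangent space at `p` is identified with `E` through the preferred chart at `p`, so
that the coordinate expressions below, taken in the preferred chart at `p` and evaluated at the
image of `p`, are vectors of the tangent space at `p`. -/

section Ambient

variable {E : Type*} [NormedAddCommGroup E] [NormedSpace ℝ E]
variable {M : Type*} [TopologicalSpace M] [ChartedSpace E M]

/-- Smooth Riemannian metrics on the manifold `M`. -/
abbrev Metric (E : Type*) [NormedAddCommGroup E] [NormedSpace ℝ E]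
    (M : Type*) [TopologicalSpace M] [ChartedSpace E M] [IsManifold 𝓘(ℝ, E) ∞ M] :=
  ContMDiffRiemannianMetric 𝓘(ℝ, E) ∞ E (fun p : M => TangentSpace 𝓘(ℝ, E) p)

/-- Families of bilinear forms on the tangent spaces. -/
abbrev BilinField (E : Type*) [NormedAddCommGroup E] [NormedSpace ℝ E]
    (M : Type*) [TopologicalSpace M] [ChartedSpace E M] :=
  ∀ p : M, TangentSpace 𝓘(ℝ, E) p →L[ℝ] TangentSpace 𝓘(ℝ, E) p →L[ℝ] ℝ

/-- Families of endomorphisms of the tangent spaces. -/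
abbrev EndField (E : Type*) [NormedAddCommGroup E] [NormedSpace ℝ E]
    (M : Type*) [TopologicalSpace M] [ChartedSpace E M] :=
  ∀ p : M, TangentSpace 𝓘(ℝ, E) p →L[ℝ] TangentSpace 𝓘(ℝ, E) p

/-- Families of covectors. -/
abbrev OneForm (E : Type*) [NormedAddCommGroup E] [NormedSpace ℝ E]
    (M : Type*) [TopologicalSpace M] [ChartedSpace E M] :=
  ∀ p : M, TangentSpace 𝓘(ℝ, E) p →L[ℝ] ℝ

/-- Raising an index: the vector `α♯` with `b (α♯, w) = α w` for all `w`. -/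
def sharp (b : E →L[ℝ] E →L[ℝ] ℝ) (α : E →L[ℝ] ℝ) : E :=
  ContinuousLinearMap.inverse b α

/-- `sharp` has its defining property for every definite form in finite dimension. -/
theorem apply_sharp [FiniteDimensional ℝ E] (b : E →L[ℝ] E →L[ℝ] ℝ)
    (hb : ∀ v, v ≠ 0 → 0 < b v v) (α : E →L[ℝ] ℝ) (w : E) : b (sharp b α) w = α w := by
  have hinj : Function.Injective b.toLinearMap := by
    rw [injective_iff_map_eq_zero]
    intro v hv
    by_contra h
    have h1 := hb v h
    have h2 : b v = 0 := hv
    rw [h2] at h1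
    simp at h1
  have hdim : Module.finrank ℝ E = Module.finrank ℝ (E →L[ℝ] ℝ) := by
    have e : (E →ₗ[ℝ] ℝ) ≃ₗ[ℝ] (E →L[ℝ] ℝ) := LinearMap.toContinuousLinearMap
    rw [← e.finrank_eq]
    exact (Subspace.dual_finrank_eq (K := ℝ) (V := E)).symm
  let e : E ≃L[ℝ] (E →L[ℝ] ℝ) :=
    (LinearEquiv.ofInjectiveOfFinrankEq b.toLinearMap hinj hdim).toContinuousLinearEquiv
  have he : (e : E →L[ℝ] (E →L[ℝ] ℝ)) = b := by
    ext v w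
    rfl
  have h3 : b (sharp b α) = α := by
    unfold sharp
    rw [← he, ContinuousLinearMap.inverse_equiv]
    exact e.apply_symm_apply α
  rw [h3]

/-- The coordinate frame of the preferred chart `φ` at `p`: the differential of `φ⁻¹` at the point
`z` of the coordinate domain, from `E` to the tangent space at `φ⁻¹ z` (which is a copy of `E`). -/
def coordFrame (p : M) (z : E) : E →L[ℝ] E :=
  mfderiv 𝓘(ℝ, E) 𝓘(ℝ, E) (extChartAt 𝓘(ℝ, E) p).symm z

/-- The coefficients of `g` in the preferred chart at `p`, as functions of the coordinates `z`. -/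
def metricInChart (g : BilinField E M) (p : M) (z : E) : E →L[ℝ] E →L[ℝ] ℝ :=
  let gz : E →L[ℝ] E →L[ℝ] ℝ := g ((extChartAt 𝓘(ℝ, E) p).symm z)
  gz.bilinearComp (coordFrame p z) (coordFrame p z)

/-- The Christoffel symbols of the first kind of a metric `G` on an open subset of `E`:
`w ↦ (∂_a G (b, w) + ∂_b G (a, w) - ∂_w G (a, b)) / 2`. -/
def christoffelForm (G : E → E →L[ℝ] E →L[ℝ] ℝ) (z a b : E) : E →L[ℝ] ℝ :=
  (1 / 2 : ℝ) • (fderiv ℝ G z a b + fderiv ℝ G z b a - ((fderiv ℝ G z).flip a).flip b)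

/-- The Christoffel symbols of the Levi-Civita connection of `g` at `p`, in the preferred chart at
`p`: `g (Γ (a, b), w) = (∂_a g (b, w) + ∂_b g (a, w) - ∂_w g (a, b)) / 2`. -/
def christoffel (g : BilinField E M) (p : M) (a b : TangentSpace 𝓘(ℝ, E) p) :
    TangentSpace 𝓘(ℝ, E) p :=
  let α : E →L[ℝ] ℝ := christoffelForm (metricInChart g p) (extChartAt 𝓘(ℝ, E) p p) a b
  sharp (E := E) (g p) α

/-- The matrix of `J` in the preferred chart at `p`, as a function of the coordinates `z`. -/
def endInChart (J : EndField E M) (p : M) (z : E) : E →L[ℝ] E :=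
  let q : M := (extChartAt 𝓘(ℝ, E) p).symm z
  let dφ : E →L[ℝ] E := mfderiv 𝓘(ℝ, E) 𝓘(ℝ, E) (extChartAt 𝓘(ℝ, E) p) q
  let Jq : E →L[ℝ] E := J q
  dφ.comp (Jq.comp (coordFrame p z))

/-- The covariant derivative `(∇_a J) b = ∇_a (J b) - J (∇_a b)` of `J` at `p` with respect to the
Levi-Civita connection `∇` of `g`. -/
def covDerivEnd (g : BilinField E M) (J : EndField E M) (p : M)
    (a b : TangentSpace 𝓘(ℝ, E) p) : TangentSpace 𝓘(ℝ, E) p :=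
  let dJ : E →L[ℝ] E →L[ℝ] E := fderiv ℝ (endInChart J p) (extChartAt 𝓘(ℝ, E) p p)
  let dJab : TangentSpace 𝓘(ℝ, E) p := dJ a b
  dJab + christoffel g p a (J p b) - J p (christoffel g p a b)

/-! ### Locally conformal Kähler manifolds -/

/-- `(M, J, g)` is an almost Hermitian manifold. -/
structure IsAlmostHermitian [IsManifold 𝓘(ℝ, E) ∞ M] (g : Metric E M) (J : EndField E M) :
    Prop where
  smooth : ContMDiff 𝓘(ℝ, E) (𝓘(ℝ, E).prod 𝓘(ℝ, E →L[ℝ] E)) ∞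
    (fun p : M => TotalSpace.mk' (E →L[ℝ] E)
      (E := fun p : M => TangentSpace 𝓘(ℝ, E) p →L[ℝ] TangentSpace 𝓘(ℝ, E) p) p (J p))
  sq : ∀ (p : M) (a : TangentSpace 𝓘(ℝ, E) p), J p (J p a) = -a
  compat : ∀ (p : M) (a b : TangentSpace 𝓘(ℝ, E) p),
    g.inner p (J p a) (J p b) = g.inner p a b

/-- The conformally changed metric `exp (-f) g`. -/
def conformal (f : M → ℝ) (g : BilinField E M) : BilinField E M :=
  fun p => Real.exp (-f p) • g p

/-- The Hermitian metric `g` is Kähler on the set `U`: the almost complex structure `J` is parallel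
for the Levi-Civita connection of `g`. -/
def IsKahlerOn (g : BilinField E M) (J : EndField E M) (U : Set M) : Prop :=
  ∀ p ∈ U, ∀ a b : TangentSpace 𝓘(ℝ, E) p, covDerivEnd g J p a b = 0

/-- `f` is a local conformal factor on the open set `U`: it is smooth, and `exp (-f) g` is a
Kähler metric on `U`. -/
def IsConformalFactor [IsManifold 𝓘(ℝ, E) ∞ M] (g : Metric E M) (J : EndField E M)
    (U : Set M) (f : M → ℝ) : Prop :=
  IsOpen U ∧ ContMDiffOn 𝓘(ℝ, E) 𝓘(ℝ, ℝ) ∞ f U ∧ IsKahlerOn (conformal f g.inner) J U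

/-- `(M, J, g)` is a locally conformal Kähler manifold. -/
def IsLocallyConformalKahler [IsManifold 𝓘(ℝ, E) ∞ M] (g : Metric E M) (J : EndField E M) :
    Prop :=
  IsAlmostHermitian g J ∧ ∀ p : M, ∃ (U : Set M) (f : M → ℝ), p ∈ U ∧ IsConformalFactor g J U f

/-- `lee` is the Lee form of `(M, J, g)`: the global one-form that is locally the differential of
a conformal factor. (In real dimension at least four it is unique.) -/
def IsLeeForm [IsManifold 𝓘(ℝ, E) ∞ M] (g : Metric E M) (J : EndField E M) (lee : OneForm E M) :
    Prop :=
  ∀ p : M, ∃ (U : Set M) (f : M → ℝ), p ∈ U ∧ IsConformalFactor g J U f ∧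
    ∀ q ∈ U, ∀ a : TangentSpace 𝓘(ℝ, E) q, lee q a = (mfderiv 𝓘(ℝ, E) 𝓘(ℝ, ℝ) f q a : ℝ)

/-- The Lee vector field `B = lee♯`. -/
def leeField [IsManifold 𝓘(ℝ, E) ∞ M] (g : Metric E M) (lee : OneForm E M) (p : M) :
    TangentSpace 𝓘(ℝ, E) p :=
  sharp (E := E) (g.inner p) (lee p)

end Ambient

/-! ### Immersed submanifolds -/

section Immersed

variable {E : Type*} [NormedAddCommGroup E] [NormedSpace ℝ E]
variable {M : Type*} [TopologicalSpace M] [ChartedSpace E M]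
variable {F : Type*} [NormedAddCommGroup F] [NormedSpace ℝ F]
variable {N : Type*} [TopologicalSpace N] [ChartedSpace F N]

/-- The differential of `f` at `q`. -/
abbrev differential (f : N → M) (q : N) :
    TangentSpace 𝓘(ℝ, F) q →L[ℝ] TangentSpace 𝓘(ℝ, E) (f q) :=
  mfderiv 𝓘(ℝ, F) 𝓘(ℝ, E) f q

/-- Smooth immersions: smooth maps whose differential is injective at every point. -/
def IsSmoothImmersion (f : N → M) : Prop :=
  ContMDiff 𝓘(ℝ, F) 𝓘(ℝ, E) ∞ f ∧
    ∀ q, Function.Injective (differential (E := E) (F := F) f q)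

/-- The tangent space of the immersed submanifold `f`, inside the ambient tangent space. -/
def tangentImage (f : N → M) (q : N) : Submodule ℝ (TangentSpace 𝓘(ℝ, E) (f q)) :=
  LinearMap.range (differential (E := E) (F := F) f q).toLinearMap

/-- The orthogonal complement of a subspace `W` of the tangent space at `p`. -/
def orthogonal [IsManifold 𝓘(ℝ, E) ∞ M] (g : Metric E M) (p : M)
    (W : Submodule ℝ (TangentSpace 𝓘(ℝ, E) p)) : Submodule ℝ (TangentSpace 𝓘(ℝ, E) p) where
  carrier := {x | ∀ w ∈ W, g.inner p x w = 0}
  add_mem' := by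
    intro x y hx hy w hw
    simp [hx w hw, hy w hw]
  zero_mem' := by
    intro w _
    simp
  smul_mem' := by
    intro c x hx w hw
    simp [hx w hw]

theorem isCompl_orthogonal [FiniteDimensional ℝ E] [IsManifold 𝓘(ℝ, E) ∞ M] (g : Metric E M)
    (p : M) (W : Submodule ℝ (TangentSpace 𝓘(ℝ, E) p)) : IsCompl (orthogonal g p W) W := by
  have : FiniteDimensional ℝ (TangentSpace 𝓘(ℝ, E) p) := inferInstanceAs (FiniteDimensional ℝ E)
  let B : LinearMap.BilinForm ℝ (TangentSpace 𝓘(ℝ, E) p) :=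
    LinearMap.mk₂ ℝ (fun x y => g.inner p x y) (by intros; simp) (by intros; simp)
      (by intros; simp) (by intros; simp)
  have hB : ∀ x y, B x y = g.inner p x y := fun _ _ => rfl
  have hrefl : B.IsRefl := by
    intro x y h
    rw [hB] at h ⊢
    rw [g.symm, h]
  have horth : B.orthogonal W = orthogonal g p W := by
    ext x
    constructor
    · intro h w hw
      rw [g.symm]
      exact h w hw
    · intro h w hw
      change g.inner p w x = 0
      rw [g.symm]
      exact h w hw
  rw [← horth]
  refine ((LinearMap.BilinForm.isCompl_orthogonal_iff_disjoint hrefl).2 ?_).symm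
  rw [horth, Submodule.disjoint_def]
  intro x hx hx'
  by_contra h
  exact (g.pos p x h).ne' (hx' x hx)

/-- The normal component of an ambient tangent vector at a point of the immersed submanifold
`f`. -/
def normalPart [FiniteDimensional ℝ E] [IsManifold 𝓘(ℝ, E) ∞ M] (g : Metric E M) (f : N → M)
    (q : N) (x : TangentSpace 𝓘(ℝ, E) (f q)) : TangentSpace 𝓘(ℝ, E) (f q) :=
  (orthogonal g (f q) (tangentImage (F := F) f q)).projection
    (tangentImage (F := F) f q) (isCompl_orthogonal g _ _) x

theorem normalPart_eq_zero_iff [FiniteDimensional ℝ E] [IsManifold 𝓘(ℝ, E) ∞ M]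
    (g : Metric E M) (f : N → M) (q : N) (x : TangentSpace 𝓘(ℝ, E) (f q)) :
    normalPart (F := F) g f q x = 0 ↔ x ∈ tangentImage (F := F) f q := by
  simp [normalPart]

/-- The ambient covariant derivative `∇̄_a (df Y)` at `q`, where `Y` is the vector field near `q`
on the source with constant components and value `b` at `q` in the preferred chart at `q`. In
coordinates it is `D²f (a, b) + Γ (df a, df b)`. -/
def covDerivDifferential (g : BilinField E M) (f : N → M) (q : N)
    (a b : TangentSpace 𝓘(ℝ, F) q) : TangentSpace 𝓘(ℝ, E) (f q) :=
  let d2f : F →L[ℝ] F →L[ℝ] E :=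
    fderiv ℝ (fderiv ℝ (writtenInExtChartAt 𝓘(ℝ, F) 𝓘(ℝ, E) q f)) (extChartAt 𝓘(ℝ, F) q q)
  let d2fab : TangentSpace 𝓘(ℝ, E) (f q) := d2f a b
  d2fab + christoffel g (f q) (differential f q a) (differential f q b)

/-- The second fundamental form `h (a, b)` of the immersed submanifold `f`: the normal component
of `∇̄_a b` (Gauss formula). -/
def secondFundamentalForm [FiniteDimensional ℝ E] [IsManifold 𝓘(ℝ, E) ∞ M] (g : Metric E M)
    (f : N → M) (q : N) (a b : TangentSpace 𝓘(ℝ, F) q) : TangentSpace 𝓘(ℝ, E) (f q) :=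
  normalPart (F := F) g f q (covDerivDifferential g.inner f q a b)

/-- The immersed submanifold `f` is totally geodesic: its second fundamental form vanishes. -/
def IsTotallyGeodesic [FiniteDimensional ℝ E] [IsManifold 𝓘(ℝ, E) ∞ M] (g : Metric E M)
    (f : N → M) : Prop :=
  ∀ (q : N) (a b : TangentSpace 𝓘(ℝ, F) q), secondFundamentalForm g f q a b = 0

end Immersed

/-! ### Distributions, integral manifolds, CR-submanifolds -/

section Distributions

variable {F : Type*} [NormedAddCommGroup F] [NormedSpace ℝ F]

/-- Families of subspaces of the tangent spaces. -/
abbrev SubspaceField (F : Type*) [NormedAddCommGroup F] [NormedSpace ℝ F]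
    (N : Type*) [TopologicalSpace N] [ChartedSpace F N] :=
  ∀ q : N, Submodule ℝ (TangentSpace 𝓘(ℝ, F) q)

/-- A smooth distribution: near every point it is spanned by a smooth frame. -/
def IsSmoothDistribution {N : Type*} [TopologicalSpace N] [ChartedSpace F N]
    [IsManifold 𝓘(ℝ, F) ∞ N] (D : SubspaceField F N) : Prop :=
  ∀ q₀ : N, ∃ U : Set N, IsOpen U ∧ q₀ ∈ U ∧
    ∃ (k : ℕ) (X : Fin k → ∀ q : N, TangentSpace 𝓘(ℝ, F) q),
      (∀ i, ContMDiffOn 𝓘(ℝ, F) 𝓘(ℝ, F).tangent ∞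
        (fun q => (⟨q, X i q⟩ : TangentBundle 𝓘(ℝ, F) N)) U) ∧
      ∀ q ∈ U, LinearIndependent ℝ (fun i => X i q) ∧
        Submodule.span ℝ (Set.range fun i => X i q) = D q

/-- `j : L → N` is an integral manifold of the distribution `D`: an injectively immersed
submanifold whose tangent space at each of its points is the subspace given by `D`. -/
def IsIntegralManifold {N : Type*} [TopologicalSpace N] [ChartedSpace F N]
    {k : ℕ} {L : Type*} [TopologicalSpace L] [ChartedSpace (EuclideanSpace ℝ (Fin k)) L]
    (D : SubspaceField F N) (j : L → N) : Prop :=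
  Function.Injective j ∧
    IsSmoothImmersion (E := F) (F := EuclideanSpace ℝ (Fin k)) j ∧
    ∀ x, tangentImage (E := F) (F := EuclideanSpace ℝ (Fin k)) j x = D (j x)

/-- The distribution `D` is integrable: through every point passes an integral manifold, that is,
`D` is tangent to a foliation, whose leaves are its maximal connected integral manifolds. -/
def IsIntegrable {N : Type u} [TopologicalSpace N] [ChartedSpace F N]
    (D : SubspaceField F N) : Prop :=
  ∀ p : N, ∃ (k : ℕ) (L : Type u) (_ : TopologicalSpace L)
    (_ : ChartedSpace (EuclideanSpace ℝ (Fin k)) L)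
    (_ : IsManifold 𝓘(ℝ, EuclideanSpace ℝ (Fin k)) ∞ L) (j : L → N),
    IsIntegralManifold (k := k) D j ∧ p ∈ Set.range j

variable {E : Type*} [NormedAddCommGroup E] [NormedSpace ℝ E] [FiniteDimensional ℝ E]
variable {M : Type*} [TopologicalSpace M] [ChartedSpace E M] [IsManifold 𝓘(ℝ, E) ∞ M]

/-- The complementary orthogonal distribution `D^⊥` in `TN` of a distribution `D` on the immersed
submanifold `ι : N → M`, for the metric induced by `g`. -/
def perp {N : Type*} [TopologicalSpace N] [ChartedSpace F N]
    (g : Metric E M) (ι : N → M) (D : SubspaceField F N) : SubspaceField F N :=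
  fun q => (orthogonal g (ι q) ((D q).map (differential ι q).toLinearMap)).comap
    (differential ι q).toLinearMap

/-- The immersed submanifold `ι : N → M` is a CR-submanifold of `(M, J, g)` with holomorphic
distribution `D`. -/
structure IsCRSubmanifold {N : Type*} [TopologicalSpace N] [ChartedSpace F N]
    [IsManifold 𝓘(ℝ, F) ∞ N] (g : Metric E M) (J : EndField E M) (ι : N → M)
    (D : SubspaceField F N) : Prop where
  immersion : IsSmoothImmersion (E := E) (F := F) ι
  smooth : IsSmoothDistribution D
  holomorphic : ∀ q, ((D q).map (differential ι q).toLinearMap).map (J (ι q)).toLinearMap =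
    (D q).map (differential ι q).toLinearMap
  totallyReal : ∀ q, ∀ z ∈ perp g ι D q,
    J (ι q) (differential ι q z) ∈ orthogonal g (ι q) (tangentImage (F := F) ι q)

/-- The immersed submanifold `ι : N → M` is ruled with respect to the distribution `D`: `D` is
tangent to a foliation of `N`, and the integral manifolds of `D` (in particular the leaves of the
foliation) are totally geodesic immersed in `(M, g)`. -/
structure IsRuled {N : Type u} [TopologicalSpace N] [ChartedSpace F N]
    (g : Metric E M) (ι : N → M) (D : SubspaceField F N) : Prop where
  integrable : IsIntegrable D
  totallyGeodesic : ∀ (k : ℕ) (L : Type u) [TopologicalSpace L]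
    [ChartedSpace (EuclideanSpace ℝ (Fin k)) L]
    [IsManifold 𝓘(ℝ, EuclideanSpace ℝ (Fin k)) ∞ L] (j : L → N),
    IsIntegralManifold (k := k) D j →
      IsTotallyGeodesic (F := EuclideanSpace ℝ (Fin k)) g (ι ∘ j)

/-- `ι : N → M` is a totally real ruled CR-submanifold of `(M, J, g)`: a CR-submanifold, with
holomorphic distribution `D`, that is ruled with respect to its totally real foliation. -/
def IsTotallyRealRuled {N : Type u} [TopologicalSpace N] [ChartedSpace F N]
    [IsManifold 𝓘(ℝ, F) ∞ N] (g : Metric E M) (J : EndField E M) (ι : N → M)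
    (D : SubspaceField F N) : Prop :=
  IsCRSubmanifold g J ι D ∧ IsRuled g ι (perp g ι D)

end Distributions

end LCK

end

/-!
The statement is local, and is proved in charts.

Let `X` be a section of the holomorphic distribution `D`, and let `a`, `b` be tangent to `D^⊥`. Since
the submanifold is totally geodesic, the ambient derivative of the section `J X` of `D` is tangent,
so it is orthogonal to the normal vector `J b`. On the other hand a locally conformal Kähler
metric has `∇ J` given by the Lee form, and when the Lee field is normal to the submanifold
every term of `⟨(∇_a J) X, J b⟩` vanishes (`bilinAt_covDerivEnd_eq_zero`). As `J` is orthogonal, it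
follows that `⟨∇_a X, b⟩ = 0`: the distribution `D^⊥` is autoparallel. In terms of the one-form `θ`
dual to `X` this says that `(∂_a θ) b = ⟨X, ∇_a b⟩` (`fderiv_dualForm`, `fderiv_chartDualForm`), with
`∇_a b` computed for constant coordinate vectors.

The right hand side is symmetric in `a` and `b`, so the exterior derivatives of the one-forms dual to
a frame of `D` vanish on their common kernel `D^⊥`, and `D^⊥` is integrable by Frobenius' theorem
(`isIntegrable_perp`). If `j` is an integral manifold of `D^⊥`, then `θ` vanishes along `j`;
differentiating this and inserting the formula for `∂ θ`, the second covariant derivative of `ι ∘ j`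
is orthogonal to `D`. It is also tangent to the submanifold, so it is tangent to `j`
(`isTotallyGeodesic_comp`).

Frobenius' theorem is proved for the total differential equation `Dy = Φ (x, y)`
(`exists_solution_total_differential`). The solution is `y x = u 1`, where `u' = Φ (t x, u) x` and
`u 0 = 0`. Differentiability of `y` does not need smooth dependence of solutions on parameters: the
integrability condition identifies the variation of `u` in the direction `h` as `t Φ (t x, u) h`, and
Grönwall's inequality bounds the error by a multiple of `‖h‖ ^ 2` (`norm_radial_variation_le`).
Smoothness then follows from the equation itself.
-/

/-! ### Total differential equations -/

namespace LCK

open Metric Filter Topology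

section TotalDifferentialEquation

variable {A B : Type*} [NormedAddCommGroup A] [NormedSpace ℝ A]
  [NormedAddCommGroup B] [NormedSpace ℝ B]

/-- The Picard-Lindelöf theorem, with the solution kept in the ball in which the vector field is
controlled. -/
theorem exists_solution_mem_closedBall [CompleteSpace B] {f : ℝ → B → B} {tmin tmax : ℝ}
    {t₀ : Icc tmin tmax} {x₀ : B} {a L K : NNReal}
    (hf : IsPicardLindelof f t₀ x₀ a 0 L K) :
    ∃ u : ℝ → B, u t₀ = x₀ ∧ ∀ t ∈ Icc tmin tmax, u t ∈ closedBall x₀ a ∧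
      HasDerivWithinAt u (f t (u t)) (Icc tmin tmax) t := by
  have hx : x₀ ∈ closedBall x₀ ((0 : NNReal) : ℝ) := by simp
  obtain ⟨α, hα⟩ := ODE.FunSpace.exists_isFixedPt_next hf hx
  refine ⟨α.compProj, by rw [ODE.FunSpace.compProj_val, ← hα, ODE.FunSpace.next_apply₀],
    fun t ht ↦ ⟨α.compProj_mem_closedBall hf.mul_max_le, ?_⟩⟩
  apply ODE.hasDerivWithinAt_picard_Icc t₀.2 hf.continuousOn_uncurry
    α.continuous_compProj.continuousOn (fun _ ht' ↦ α.compProj_mem_closedBall hf.mul_max_le)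
    x₀ ht |>.congr_of_mem _ ht
  intro t' ht'
  nth_rw 1 [← hα]
  rw [ODE.FunSpace.compProj_of_mem ht', ODE.FunSpace.next_apply]

/-- `Φ` is bounded by `K` on the closed ball of radius `ρ`, together with its first order Taylor
expansion, `Φ'` being the derivative. -/
structure TaylorBound (Φ : A × B → A →L[ℝ] B) (Φ' : A × B → A × B →L[ℝ] A →L[ℝ] B)
    (K ρ : ℝ) : Prop where
  nonneg : 0 ≤ K
  hasFDerivAt : ∀ p ∈ closedBall (0 : A × B) ρ, HasFDerivAt Φ (Φ' p) p
  norm_le : ∀ p ∈ closedBall (0 : A × B) ρ, ‖Φ p‖ ≤ K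
  norm_deriv_le : ∀ p ∈ closedBall (0 : A × B) ρ, ‖Φ' p‖ ≤ K
  norm_sub_le : ∀ p ∈ closedBall (0 : A × B) ρ, ∀ p' ∈ closedBall (0 : A × B) ρ,
    ‖Φ p' - Φ p‖ ≤ K * ‖p' - p‖
  taylor : ∀ p ∈ closedBall (0 : A × B) ρ, ∀ p' ∈ closedBall (0 : A × B) ρ,
    ‖Φ p' - Φ p - Φ' p (p' - p)‖ ≤ K * ‖p' - p‖ ^ 2

set_option synthInstance.maxHeartbeats 200000 in
/-- A twice continuously differentiable map satisfies a Taylor bound near the origin. -/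
theorem exists_taylorBound {Φ : A × B → A →L[ℝ] B} (h : ContDiffAt ℝ 2 Φ 0)
    {W : Set (A × B)} (hW : W ∈ 𝓝 (0 : A × B)) :
    ∃ K ρ : ℝ, 0 < ρ ∧ closedBall 0 ρ ⊆ W ∧ TaylorBound Φ (fderiv ℝ Φ) K ρ := by
  have h1 : ContDiffAt ℝ 1 (fderiv ℝ Φ) 0 := h.fderiv_right (by norm_num)
  obtain ⟨K₁, s₁, hs₁, hl₁⟩ := h1.exists_lipschitzOnWith
  obtain ⟨K₀, s₀, hs₀, hl₀⟩ := (h.of_le (by norm_num : (1 : ℕ∞ω) ≤ 2)).exists_lipschitzOnWith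
  have hd : ∀ᶠ p in 𝓝 (0 : A × B), DifferentiableAt ℝ Φ p :=
    (h.eventually (by simp)).mono fun p hp => hp.differentiableAt (by norm_num)
  have hb : ∀ᶠ p in 𝓝 (0 : A × B), ‖Φ p‖ < ‖Φ 0‖ + 1 :=
    h.continuousAt.norm.eventually_lt_const (by simp)
  have hb' : ∀ᶠ p in 𝓝 (0 : A × B), ‖fderiv ℝ Φ p‖ ≤ K₀ :=
    (eventually_mem_nhds_iff.2 hs₀).mono fun p hp => norm_fderiv_le_of_lipschitzOn ℝ hp hl₀
  obtain ⟨ρ, hρ, hball⟩ := nhds_basis_closedBall.mem_iff.1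
    (inter_mem (inter_mem hW (inter_mem hs₁ hs₀)) (inter_mem hd (inter_mem hb hb')))
  set K : ℝ := max (max K₁ K₀) (‖Φ 0‖ + 1) with hK
  have hK₁ : (K₁ : ℝ) ≤ K := (le_max_left _ _).trans (le_max_left _ _)
  have hK₀ : (K₀ : ℝ) ≤ K := (le_max_right _ _).trans (le_max_left _ _)
  have hK₂ : ‖Φ 0‖ + 1 ≤ K := le_max_right _ _
  refine ⟨K, ρ, hρ, fun p hp => (hball hp).1.1, K₁.2.trans hK₁,
    fun p hp => (show DifferentiableAt ℝ Φ p from (hball hp).2.1).hasFDerivAt,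
    fun p hp => le_trans (le_of_lt (hball hp).2.2.1) hK₂,
    fun p hp => le_trans (hball hp).2.2.2 hK₀, ?_, ?_⟩
  · intro p hp p' hp'
    exact (hl₀.norm_sub_le (hball hp').1.2.2 (hball hp).1.2.2).trans (by gcongr)
  · intro p hp p' hp'
    have hseg : segment ℝ p p' ⊆ closedBall 0 ρ := (convex_closedBall _ _).segment_subset hp hp'
    have := (convex_segment p p').norm_image_sub_le_of_norm_hasFDerivWithin_le'
      (f := Φ) (f' := fderiv ℝ Φ) (φ := fderiv ℝ Φ p) (C := K * ‖p' - p‖)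
      (fun q hq => (show DifferentiableAt ℝ Φ q from
        (hball (hseg hq)).2.1).hasFDerivAt.hasFDerivWithinAt)
      (fun q hq => by
        refine (hl₁.norm_sub_le (hball (hseg hq)).1.2.1 (hball hp).1.2.1).trans ?_
        gcongr
        exact norm_sub_le_of_mem_segment hq)
      (left_mem_segment ℝ p p') (right_mem_segment ℝ p p')
    calc _ ≤ K * ‖p' - p‖ * ‖p' - p‖ := this
      _ = _ := by ring

/-- Second order dependence of the solutions of `u' = Φ (t x, u) x`, `u 0 = 0`, on `x`. The
integrability condition makes `t Φ (t x, u) h` the variation of `u` in the direction `h`, up to an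
error controlled by Grönwall's inequality. -/
theorem norm_radial_variation_le {Φ : A × B → A →L[ℝ] B} {Φ' : A × B → A × B →L[ℝ] A →L[ℝ] B}
    {K ρ : ℝ} (hΦ : TaylorBound Φ Φ' K ρ)
    (hint : ∀ p ∈ closedBall (0 : A × B) ρ, ∀ a b : A, Φ' p (a, Φ p a) b = Φ' p (b, Φ p b) a) :
    ∃ C : ℝ, ∀ (x h : A) (u v : ℝ → B), ‖x‖ ≤ 1 → ‖h‖ ≤ 1 → u 0 = 0 → v 0 = 0 →
      (∀ t ∈ Icc (0 : ℝ) 1, (t • x, u t) ∈ closedBall (0 : A × B) ρ ∧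
        HasDerivWithinAt u (Φ (t • x, u t) x) (Icc 0 1) t) →
      (∀ t ∈ Icc (0 : ℝ) 1, (t • (x + h), v t) ∈ closedBall (0 : A × B) ρ ∧
        HasDerivWithinAt v (Φ (t • (x + h), v t) (x + h)) (Icc 0 1) t) →
      ‖v 1 - u 1 - Φ (x, u 1) h‖ ≤ C * ‖h‖ ^ 2 := by
  have hK := hΦ.nonneg
  by_cases hρ : 0 ≤ ρ
  swap
  · refine ⟨0, fun x h u v _ _ _ _ hu _ => ?_⟩
    have := (hu 0 (by simp)).1
    rw [closedBall_eq_empty.2 (not_le.1 hρ)] at this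
    exact this.elim
  set M : ℝ := 2 * ρ + K
  set K' : ℝ := K * (2 * M + 2) + 1
  have hK' : 0 < K' := by positivity
  set C : ℝ := K * (2 * (1 + K) ^ 2 + (1 + K))
  refine ⟨C / K' * (Real.exp K' - 1), fun x h u v hx hh hu0 hv0 hu hv => ?_⟩
  set e : ℝ → B := fun t => v t - u t - t • Φ (t • x, u t) h
  -- the derivative of the error `e`
  set e' : ℝ → B := fun t => Φ (t • (x + h), v t) (x + h) - Φ (t • x, u t) x -
    (Φ (t • x, u t) h + t • Φ' (t • x, u t) (x, Φ (t • x, u t) x) h)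
  have he : ∀ t ∈ Icc (0 : ℝ) 1, HasDerivWithinAt e (e' t) (Icc 0 1) t := by
    intro t ht
    have hc : HasDerivWithinAt (fun t => (t • x, u t)) (x, Φ (t • x, u t) x) (Icc 0 1) t := by
      refine HasDerivWithinAt.prodMk ?_ (hu t ht).2
      simpa using (hasDerivWithinAt_id t (Icc (0 : ℝ) 1)).smul_const x
    have h1 := (hΦ.hasFDerivAt _ (hu t ht).1).comp_hasDerivWithinAt t hc
    have h2 := (hasDerivWithinAt_id t (Icc (0 : ℝ) 1)).smul
      (h1.clm_apply (hasDerivWithinAt_const t (Icc (0 : ℝ) 1) h))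
    refine (((hv t ht).2.sub (hu t ht).2).sub h2).congr_deriv ?_
    simp [e', add_comm]
  have hbound : ∀ t ∈ Icc (0 : ℝ) 1, ‖e' t‖ ≤ K' * ‖e t‖ + C * ‖h‖ ^ 2 := by
    intro t ht
    have hp := (hu t ht).1
    have hp' := (hv t ht).1
    set p : A × B := (t • x, u t) with hp_def
    set p' : A × B := (t • (x + h), v t) with hp'_def
    have htn : ‖t‖ ≤ 1 := by rw [Real.norm_eq_abs, abs_of_nonneg ht.1]; exact ht.2
    have hsub : p' - p = t • (h, Φ p h) + (0, e t) := by
      ext <;> simp [p, p', e]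
    have hn : 0 ≤ ‖h‖ := norm_nonneg _
    have hen : 0 ≤ ‖e t‖ := norm_nonneg _
    have hΦh : ‖Φ p h‖ ≤ K * ‖h‖ := (Φ p).le_of_opNorm_le (hΦ.norm_le p hp) h
    have hδ : ‖p' - p‖ ≤ (1 + K) * ‖h‖ + ‖e t‖ := by
      rw [hsub]
      refine (norm_add_le _ _).trans (add_le_add ?_ (by simp [Prod.norm_def]))
      rw [norm_smul]
      have : ‖(h, Φ p h)‖ ≤ (1 + K) * ‖h‖ := by
        rw [Prod.norm_def]
        exact max_le (by nlinarith) (by nlinarith)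
      calc ‖t‖ * ‖(h, Φ p h)‖ ≤ 1 * ((1 + K) * ‖h‖) := by gcongr
        _ = _ := one_mul _
    have heM : ‖e t‖ ≤ M := by
      have h1 : ‖v t‖ ≤ ρ := (norm_snd_le p').trans (by simpa using hp')
      have h2 : ‖u t‖ ≤ ρ := (norm_snd_le p).trans (by simpa using hp)
      have h3 : ‖t • Φ p h‖ ≤ K := by
        rw [norm_smul]
        calc ‖t‖ * ‖Φ p h‖ ≤ 1 * (K * 1) := by
              gcongr
              exact hΦh.trans (by gcongr)
          _ = K := by ring
      calc ‖e t‖ ≤ ‖v t‖ + ‖u t‖ + ‖t • Φ p h‖ :=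
            (norm_sub_le _ _).trans (add_le_add_left (norm_sub_le _ _) _)
        _ ≤ M := by simp only [M]; linarith
    have hdecomp : e' t = (Φ p' - Φ p - Φ' p (p' - p)) x + Φ' p (0, e t) x + (Φ p' - Φ p) h := by
      have h1 : Φ' p (p' - p) x = t • Φ' p (x, Φ p x) h + Φ' p (0, e t) x := by
        rw [hsub, map_add, map_smul, hint p hp x h]
        simp
      simp only [sub_apply, h1, e', map_add]
      abel
    have b1 : ‖(Φ p' - Φ p - Φ' p (p' - p)) x‖ ≤ K * ‖p' - p‖ ^ 2 := by
      calc _ ≤ (K * ‖p' - p‖ ^ 2) * ‖x‖ :=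
            ContinuousLinearMap.le_of_opNorm_le _ (hΦ.taylor p hp p' hp') x
        _ ≤ (K * ‖p' - p‖ ^ 2) * 1 := by gcongr
        _ = _ := mul_one _
    have b2 : ‖Φ' p (0, e t) x‖ ≤ K * ‖e t‖ := by
      have h2 : ‖Φ' p (0, e t)‖ ≤ K * ‖e t‖ := by
        simpa [Prod.norm_def] using
          ContinuousLinearMap.le_of_opNorm_le _ (hΦ.norm_deriv_le p hp) (0, e t)
      calc _ ≤ (K * ‖e t‖) * ‖x‖ := ContinuousLinearMap.le_of_opNorm_le _ h2 x
        _ ≤ (K * ‖e t‖) * 1 := by gcongr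
        _ = _ := mul_one _
    have b3 : ‖(Φ p' - Φ p) h‖ ≤ K * ‖p' - p‖ * ‖h‖ :=
      ContinuousLinearMap.le_of_opNorm_le _ (hΦ.norm_sub_le p hp p' hp') h
    have b4 : ‖p' - p‖ ^ 2 ≤ 2 * (1 + K) ^ 2 * ‖h‖ ^ 2 + 2 * M * ‖e t‖ := by
      calc ‖p' - p‖ ^ 2 ≤ ((1 + K) * ‖h‖ + ‖e t‖) ^ 2 := by gcongr
        _ ≤ 2 * (1 + K) ^ 2 * ‖h‖ ^ 2 + 2 * ‖e t‖ ^ 2 := by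
            linarith [sq_nonneg ((1 + K) * ‖h‖ - ‖e t‖)]
        _ ≤ _ := by nlinarith
    have b5 : ‖p' - p‖ * ‖h‖ ≤ (1 + K) * ‖h‖ ^ 2 + ‖e t‖ := by
      calc ‖p' - p‖ * ‖h‖ ≤ ((1 + K) * ‖h‖ + ‖e t‖) * ‖h‖ := by gcongr
        _ ≤ _ := by nlinarith
    calc ‖e' t‖ ≤ K * ‖p' - p‖ ^ 2 + K * ‖e t‖ + K * ‖p' - p‖ * ‖h‖ := by
          rw [hdecomp]
          exact (norm_add_le _ _).trans
            (add_le_add ((norm_add_le _ _).trans (add_le_add b1 b2)) b3)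
      _ = K * (‖p' - p‖ ^ 2 + ‖e t‖ + ‖p' - p‖ * ‖h‖) := by ring
      _ ≤ K * ((2 * (1 + K) ^ 2 * ‖h‖ ^ 2 + 2 * M * ‖e t‖) + ‖e t‖ +
            ((1 + K) * ‖h‖ ^ 2 + ‖e t‖)) := by gcongr
      _ = (K' - 1) * ‖e t‖ + C * ‖h‖ ^ 2 := by simp only [K', C]; ring
      _ ≤ _ := by linarith
  have hgr := norm_le_gronwallBound_of_norm_deriv_right_le (f := e) (f' := e') (δ := 0)
    (fun t ht => (he t ht).continuousWithinAt)
    (fun t ht => (he t (Ico_subset_Icc_self ht)).mono_of_mem_nhdsWithin (Icc_mem_nhdsGE_of_mem ht))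
    (by simp [e, hu0, hv0]) (fun t ht => hbound t (Ico_subset_Icc_self ht)) 1 (by simp)
  rw [gronwallBound_of_K_ne_0 hK'.ne'] at hgr
  have he1 : e 1 = v 1 - u 1 - Φ (x, u 1) h := by simp [e]
  rw [he1] at hgr
  refine hgr.trans (le_of_eq ?_)
  simp
  ring

/-- **Frobenius' theorem**, for a total differential equation `Dy = Φ (x, y)`: if the second
derivative of a solution, as prescribed by the equation, is symmetric, then a smooth solution
exists near the origin. -/
theorem exists_solution_total_differential [CompleteSpace B] {Φ : A × B → A →L[ℝ] B}
    {W : Set (A × B)} (hW : IsOpen W) (h0 : 0 ∈ W) (hΦ : ContDiffOn ℝ ∞ Φ W)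
    (hint : ∀ p ∈ W, ∀ a b : A, fderiv ℝ Φ p (a, Φ p a) b = fderiv ℝ Φ p (b, Φ p b) a) :
    ∃ (r : ℝ) (y : A → B), 0 < r ∧ y 0 = 0 ∧ ContDiffOn ℝ ∞ y (ball 0 r) ∧
      ∀ x ∈ ball (0 : A) r, (x, y x) ∈ W ∧ HasFDerivAt y (Φ (x, y x)) x := by
  obtain ⟨K, ρ, hρ, hρW, hT⟩ := exists_taylorBound (W := W)
    ((contDiffOn_infty.1 hΦ 2).contDiffAt (hW.mem_nhds h0)) (hW.mem_nhds h0)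
  obtain ⟨C, hC⟩ := norm_radial_variation_le hT (fun p hp => hint p (hρW hp))
  have hK := hT.nonneg
  set r : ℝ := min (min ρ (1 / 2)) (ρ / (K + 1)) with hr_def
  have hr : 0 < r := by positivity
  have hrρ : r ≤ ρ := (min_le_left _ _).trans (min_le_left _ _)
  have hr1 : r ≤ 1 / 2 := (min_le_left _ _).trans (min_le_right _ _)
  have hKr : K * r ≤ ρ := by
    have : r ≤ ρ / (K + 1) := min_le_right _ _
    rw [le_div_iff₀ (by positivity)] at this
    nlinarith
  have hmem : ∀ x : A, ‖x‖ < r → ∀ t ∈ Icc (0 : ℝ) 1, ∀ z ∈ closedBall (0 : B) ρ,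
      (t • x, z) ∈ closedBall (0 : A × B) ρ := by
    intro x hx t ht z hz
    rw [mem_closedBall_zero_iff] at hz ⊢
    refine max_le ?_ hz
    rw [norm_smul, Real.norm_eq_abs, abs_of_nonneg ht.1]
    nlinarith [norm_nonneg x, ht.2]
  -- the solutions along the rays
  have hray : ∀ x : A, ∃ u : ℝ → B, ‖x‖ < r → u 0 = 0 ∧ ∀ t ∈ Icc (0 : ℝ) 1,
      (t • x, u t) ∈ closedBall (0 : A × B) ρ ∧
        HasDerivWithinAt u (Φ (t • x, u t) x) (Icc 0 1) t := by
    intro x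
    by_cases hx : ‖x‖ < r
    swap
    · exact ⟨0, fun h => absurd h hx⟩
    have hPL : IsPicardLindelof (fun t u => Φ (t • x, u) x) (tmin := 0) (tmax := 1)
        ⟨0, by simp⟩ 0 ⟨ρ, hρ.le⟩ 0 ⟨K * ‖x‖, by positivity⟩ ⟨K * ‖x‖, by positivity⟩ := by
      refine ⟨fun t ht => LipschitzOnWith.of_dist_le_mul fun z hz z' hz' => ?_, fun z hz => ?_,
        fun t ht z hz => ?_, ?_⟩
      · rw [dist_eq_norm, dist_eq_norm, ← sub_apply]
        refine (ContinuousLinearMap.le_of_opNorm_le _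
          (hT.norm_sub_le _ (hmem x hx t ht z' hz') _ (hmem x hx t ht z hz)) x).trans ?_
        have h1 : ‖((t • x, z) : A × B) - (t • x, z')‖ = ‖z - z'‖ := by simp [Prod.norm_def]
        rw [h1]
        change K * ‖z - z'‖ * ‖x‖ ≤ K * ‖x‖ * ‖z - z'‖
        exact (mul_right_comm _ _ _).le
      · have h1 : ContinuousOn Φ (closedBall 0 ρ) :=
          fun p hp => (hT.hasFDerivAt p hp).continuousAt.continuousWithinAt
        have h2 : ContinuousOn (fun t : ℝ => Φ (t • x, z)) (Icc 0 1) :=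
          h1.comp (by fun_prop) fun t ht => hmem x hx t ht z hz
        exact h2.clm_apply continuousOn_const
      · exact ContinuousLinearMap.le_of_opNorm_le _ (hT.norm_le _ (hmem x hx t ht z hz)) x
      · simp only [sub_zero, max_eq_left zero_le_one, mul_one, NNReal.coe_zero]
        exact (mul_le_mul_of_nonneg_left hx.le hK).trans hKr
    obtain ⟨u, hu0, hu⟩ := exists_solution_mem_closedBall hPL
    exact ⟨u, fun _ => ⟨hu0, fun t ht => ⟨hmem x hx t ht _ (hu t ht).1, (hu t ht).2⟩⟩⟩
  choose u hu using hray
  set y : A → B := fun x => u x 1 with hy_def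
  have hyW : ∀ x ∈ ball (0 : A) r, (x, y x) ∈ W := by
    intro x hx
    have := ((hu x (mem_ball_zero_iff.1 hx)).2 1 (by simp)).1
    rw [one_smul] at this
    exact hρW this
  have hy' : ∀ x ∈ ball (0 : A) r, HasFDerivAt y (Φ (x, y x)) x := by
    intro x hx
    rw [hasFDerivAt_iff_isLittleO_nhds_zero]
    refine Asymptotics.IsBigO.trans_isLittleO (Asymptotics.IsBigO.of_bound C ?_)
      (Asymptotics.isLittleO_norm_pow_id one_lt_two)
    have hnear : ∀ᶠ h in 𝓝 (0 : A), x + h ∈ ball (0 : A) r := by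
      refine ContinuousAt.eventually_mem (f := fun h : A => x + h) (by fun_prop) ?_
      simpa using isOpen_ball.mem_nhds hx
    filter_upwards [hnear, ball_mem_nhds (0 : A) one_pos] with h hxh hh
    rw [mem_ball_zero_iff] at hx hxh hh
    rw [norm_pow, norm_norm]
    exact hC x h (u x) (u (x + h)) (by linarith) hh.le (hu x hx).1 (hu _ hxh).1 (hu x hx).2
      (hu _ hxh).2
  have hsmooth : ∀ n : ℕ, ContDiffOn ℝ n y (ball 0 r) := by
    intro n
    induction n with
    | zero =>
      exact contDiffOn_zero.2 fun x hx => (hy' x hx).continuousAt.continuousWithinAt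
    | succ n ih =>
      push_cast
      rw [contDiffOn_succ_iff_fderiv_of_isOpen isOpen_ball]
      refine ⟨fun x hx => (hy' x hx).differentiableAt.differentiableWithinAt, by simp, ?_⟩
      have h1 : ContDiffOn ℝ n (fun x => Φ (x, y x)) (ball 0 r) :=
        (hΦ.of_le (by exact_mod_cast le_top)).comp (contDiffOn_id.prodMk ih) hyW
      exact h1.congr fun x hx => (hy' x hx).fderiv
  refine ⟨r, y, hr, ?_, contDiffOn_infty.2 hsmooth, fun x hx => ⟨hyW x hx, hy' x hx⟩⟩
  have hu0 := hu 0 (by simpa using hr)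
  have := constant_of_has_deriv_right_zero (f := u 0) (a := 0) (b := 1)
    (fun t ht => (hu0.2 t ht).2.continuousWithinAt)
    (fun t ht => by
      have := (hu0.2 t (Ico_subset_Icc_self ht)).2
      rw [map_zero] at this
      exact this.mono_of_mem_nhdsWithin (Icc_mem_nhdsGE_of_mem ht)) 1 (by simp)
  rw [hy_def]
  simp only [this, hu0.1]

end TotalDifferentialEquation
end LCK

/-! ### Integral manifolds of kernels of one-forms -/

namespace LCK

open Metric Filter Topology

section Kernel

variable {F B : Type*} [NormedAddCommGroup F] [NormedSpace ℝ F] [FiniteDimensional ℝ F]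
  [NormedAddCommGroup B] [NormedSpace ℝ B] [FiniteDimensional ℝ B]

/-- **Frobenius' theorem** for the kernel of a vector valued one-form `T` on an open subset of a
vector space: if `dT` vanishes on the kernel, then the kernel has an integral manifold through
`z₀`. Near `z₀` the kernel is the graph of a map `Φ` into a complement, and integral manifolds are
the graphs of the solutions of `Dy = Φ (x, y)`. -/
theorem exists_integral_of_ker {T : F → F →L[ℝ] B} {U : Set F} (hU : IsOpen U)
    {z₀ : F} (hz₀ : z₀ ∈ U) (hT : ContDiffOn ℝ ∞ T U) (hsurj : Function.Surjective (T z₀))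
    (hint : ∀ z ∈ U, ∀ v w : F, T z v = 0 → T z w = 0 → fderiv ℝ T z v w = fderiv ℝ T z w v) :
    ∃ (k : ℕ) (r : ℝ) (j : EuclideanSpace ℝ (Fin k) → F), 0 < r ∧ j 0 = z₀ ∧
      ContDiffOn ℝ ∞ j (ball 0 r) ∧ InjOn j (ball 0 r) ∧
      ∀ x ∈ ball (0 : EuclideanSpace ℝ (Fin k)) r, j x ∈ U ∧
        ∃ j' : EuclideanSpace ℝ (Fin k) →L[ℝ] F, HasFDerivAt j j' x ∧ Function.Injective j' ∧
          ∀ v, v ∈ range j' ↔ T (j x) v = 0 := by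
  obtain ⟨s₀, hs₀⟩ := LinearMap.exists_rightInverse_of_surjective (T z₀).toLinearMap
    (LinearMap.range_eq_top.2 hsurj)
  set s : B →L[ℝ] F := s₀.toContinuousLinearMap
  have hs : ∀ b, T z₀ (s b) = b := fun b => LinearMap.congr_fun hs₀ b
  set k := Module.finrank ℝ (LinearMap.ker (T z₀).toLinearMap)
  let ek : EuclideanSpace ℝ (Fin k) ≃L[ℝ] LinearMap.ker (T z₀).toLinearMap :=
    ContinuousLinearEquiv.ofFinrankEq (by simp [k])
  set A := EuclideanSpace ℝ (Fin k)
  set i : A →L[ℝ] F := (Submodule.subtypeL _).comp ek.toContinuousLinearMap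
  have hi : Function.Injective i := Subtype.val_injective.comp ek.injective
  have hTi : ∀ a, T z₀ (i a) = 0 := fun a => (ek a).2
  set σ' : A × B →L[ℝ] F := i.coprod s
  set σ : A × B → F := fun p => z₀ + σ' p
  have hσ : ∀ p, HasFDerivAt σ σ' p := fun p => σ'.hasFDerivAt.const_add z₀
  have hσsm : ContDiff ℝ ∞ σ := contDiff_const.add σ'.contDiff
  have hσinj : ∀ a b a' b', i a + s b = i a' + s b' → a = a' ∧ b = b' := by
    intro a b a' b' h
    have h1 := congrArg (T z₀) h
    simp only [map_add, hTi, hs, zero_add] at h1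
    subst h1
    exact ⟨hi (add_right_cancel h), rfl⟩
  set S : A × B → B →L[ℝ] B := fun p => (T (σ p)).comp s
  have hSU : ContDiffOn ℝ ∞ (fun p => T (σ p)) (σ ⁻¹' U) :=
    hT.comp hσsm.contDiffOn fun p hp => hp
  have hSsm : ContDiffOn ℝ ∞ S (σ ⁻¹' U) := hSU.clm_comp contDiffOn_const
  have hσU : IsOpen (σ ⁻¹' U) := hU.preimage hσsm.continuous
  set W : Set (A × B) := σ ⁻¹' U ∩ S ⁻¹' range ((↑) : (B ≃L[ℝ] B) → B →L[ℝ] B) with hW_def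
  have hW : IsOpen W := hSsm.continuousOn.isOpen_inter_preimage hσU
    (ContinuousLinearEquiv.isOpen (𝕜 := ℝ) (E := B) (F := B))
  have h0W : (0 : A × B) ∈ W := by
    refine ⟨by simpa [σ] using hz₀, ContinuousLinearEquiv.refl ℝ B, ?_⟩
    ext1 b
    simp [S, σ, hs]
  set Φ : A × B → A →L[ℝ] B := fun p => -((S p).inverse.comp ((T (σ p)).comp i))
  have hSinv : ContDiffOn ℝ ∞ (fun p => (S p).inverse) W := by
    intro p hp
    obtain ⟨e, he⟩ := hp.2
    have h1 : ContDiffAt ℝ ∞ ContinuousLinearMap.inverse (S p) := by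
      rw [← he]
      exact contDiffAt_map_inverse e
    exact h1.comp_contDiffWithinAt p ((hSsm p hp.1).mono inter_subset_left)
  have hΦ : ContDiffOn ℝ ∞ Φ W :=
    (hSinv.clm_comp ((hSU.mono inter_subset_left).clm_comp contDiffOn_const)).neg
  -- `(a, Φ a)` parametrizes the kernel
  have hker : ∀ p ∈ W, ∀ a, T (σ p) (i a + s (Φ p a)) = 0 := by
    intro p hp a
    obtain ⟨e, he⟩ := hp.2
    have h1 : T (σ p) (s (Φ p a)) = S p (Φ p a) := rfl
    rw [map_add, h1]
    simp only [Φ, ← he, ContinuousLinearMap.inverse_equiv, neg_apply,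
      ContinuousLinearMap.comp_apply, map_neg, ContinuousLinearEquiv.coe_coe,
      ContinuousLinearEquiv.apply_symm_apply, add_neg_cancel]
  have hSinj : ∀ p ∈ W, Function.Injective (S p) := by
    intro p hp
    obtain ⟨e, he⟩ := hp.2
    rw [← he]
    exact e.injective
  have hΦint : ∀ p ∈ W, ∀ a b : A,
      fderiv ℝ Φ p (a, Φ p a) b = fderiv ℝ Φ p (b, Φ p b) a := by
    intro p hp a b
    have hΦd : HasFDerivAt Φ (fderiv ℝ Φ p) p :=
      ((hΦ.contDiffAt (hW.mem_nhds hp)).differentiableAt (by simp)).hasFDerivAt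
    have hTd : HasFDerivAt T (fderiv ℝ T (σ p)) (σ p) :=
      ((hT.contDiffAt (hU.mem_nhds hp.1)).differentiableAt (by simp)).hasFDerivAt
    -- differentiate `T (i a + s (Φ a)) = 0`
    have key : ∀ a b : A, S p (fderiv ℝ Φ p (b, Φ p b) a) =
        -fderiv ℝ T (σ p) (i b + s (Φ p b)) (i a + s (Φ p a)) := by
      intro a b
      have h1 : HasFDerivAt (fun q => i a + s (Φ q a))
          (s.comp ((ContinuousLinearMap.apply ℝ B a).comp (fderiv ℝ Φ p))) p := by
        refine HasFDerivAt.const_add _ ?_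
        exact s.hasFDerivAt.comp p
          ((ContinuousLinearMap.apply ℝ B a).hasFDerivAt.comp p hΦd)
      have h2 := (hTd.comp p (hσ p)).clm_apply h1
      have h3 : HasFDerivAt (fun q => T (σ q) (i a + s (Φ q a))) (0 : A × B →L[ℝ] B) p := by
        refine (hasFDerivAt_const (0 : B) p).congr_of_eventuallyEq ?_
        filter_upwards [hW.mem_nhds hp] with q hq using hker q hq a
      have h4 := DFunLike.congr_fun (h2.unique h3) (b, Φ p b)
      simp [σ'] at h4
      rw [← add_eq_zero_iff_eq_neg, ← h4]
      simp only [S, ContinuousLinearMap.comp_apply, map_add, add_apply]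
    apply hSinj p hp
    rw [key, key, hint _ hp.1 _ _ (hker p hp a) (hker p hp b)]
  obtain ⟨r, y, hr, hy0, hysm, hy⟩ := exists_solution_total_differential hW h0W hΦ hΦint
  refine ⟨k, r, fun x => σ (x, y x), hr, ?_, ?_, ?_, ?_⟩
  · simp [hy0, σ, σ']
  · exact hσsm.comp_contDiffOn (contDiffOn_id.prodMk hysm)
  · intro x hx x' hx' h
    exact (hσinj x (y x) x' (y x') (by simpa [σ, σ'] using h)).1
  · intro x hx
    obtain ⟨hxW, hyx⟩ := hy x hx
    refine ⟨hxW.1, _, (hσ _).comp x ((hasFDerivAt_id x).prodMk hyx), ?_, ?_⟩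
    · intro a a' h
      exact (hσinj a _ a' _ (by simpa [σ'] using h)).1
    · intro v
      constructor
      · rintro ⟨a, rfl⟩
        simpa [σ'] using hker _ hxW a
      · intro hv
        obtain ⟨a, ha⟩ := ek.surjective ⟨v - s (T z₀ v), by simp [hs]⟩
        have hia : i a = v - s (T z₀ v) := congrArg Subtype.val ha
        -- a vector of the kernel is determined by its component along `i`
        have h1 : Φ (x, y x) a = T z₀ v := by
          apply hSinj _ hxW
          have h2 := hker _ hxW a
          have h3 : T (σ (x, y x)) (i a) = -S (x, y x) (T z₀ v) := by
            rw [hia, map_sub, hv, zero_sub]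
            rfl
          rw [map_add, h3, neg_add_eq_zero] at h2
          exact h2.symm
        refine ⟨a, ?_⟩
        simp [σ', h1, hia]

end Kernel
end LCK

/-! ### Calculus in coordinates -/

namespace LCK

open Filter Topology

section Coordinates

set_option synthInstance.maxHeartbeats 200000

variable {E F : Type*} [NormedAddCommGroup E] [NormedSpace ℝ E]
  [NormedAddCommGroup F] [NormedSpace ℝ F]

theorem christoffelForm_apply (G : E → E →L[ℝ] E →L[ℝ] ℝ) (z a b w : E) :
    christoffelForm G z a b w =
      (1 / 2) * (fderiv ℝ G z a b w + fderiv ℝ G z b a w - fderiv ℝ G z w a b) := by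
  simp [christoffelForm]

theorem hasFDerivAt_exp_neg_smul {V : Type*} [NormedAddCommGroup V] [NormedSpace ℝ V] {G : E → V}
    {c : E → ℝ} {z : E} (hG : DifferentiableAt ℝ G z) (hc : DifferentiableAt ℝ c z) :
    HasFDerivAt (fun y => Real.exp (-c y) • G y)
      (Real.exp (-c z) • fderiv ℝ G z +
        (Real.exp (-c z) • (-fderiv ℝ c z)).smulRight (G z)) z := by
  have h1 : HasFDerivAt (fun y => Real.exp (-c y)) (Real.exp (-c z) • (-fderiv ℝ c z)) z :=
    hc.hasFDerivAt.neg.exp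
  exact h1.fun_smul hG.hasFDerivAt

/-- The Christoffel symbols of a conformally changed metric. -/
theorem christoffelForm_conformal {G : E → E →L[ℝ] E →L[ℝ] ℝ} {c : E → ℝ} {z : E}
    (hG : DifferentiableAt ℝ G z) (hc : DifferentiableAt ℝ c z) (a b w : E) :
    christoffelForm (fun y => Real.exp (-c y) • G y) z a b w =
      Real.exp (-c z) * (christoffelForm G z a b w -
        (1 / 2) * (fderiv ℝ c z a * G z b w + fderiv ℝ c z b * G z a w -
          fderiv ℝ c z w * G z a b)) := by
  have h := hasFDerivAt_exp_neg_smul (V := E →L[ℝ] E →L[ℝ] ℝ) hG hc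
  simp only [christoffelForm_apply, h.fderiv]
  simp
  ring

/-- If an injective differentiable family of linear maps sends `Y z` to a differentiable `R z`,
then `Y` is differentiable. -/
theorem differentiableAt_of_apply_eq [FiniteDimensional ℝ E] [FiniteDimensional ℝ F]
    {A : F → F →L[ℝ] E} {R : F → E} {Y : F → F} {z : F} (hA : DifferentiableAt ℝ A z)
    (hR : DifferentiableAt ℝ R z) (hinj : Function.Injective (A z))
    (h : ∀ᶠ y in 𝓝 z, A y (Y y) = R y) : DifferentiableAt ℝ Y z := by
  obtain ⟨P₀, hP₀⟩ := LinearMap.exists_leftInverse_of_injective (A z).toLinearMap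
    (LinearMap.ker_eq_bot.2 hinj)
  set P : E →L[ℝ] F := P₀.toContinuousLinearMap
  have hP : P.comp (A z) = (ContinuousLinearEquiv.refl ℝ F : F →L[ℝ] F) := by
    ext1 v
    exact LinearMap.congr_fun hP₀ v
  set Q : F → F →L[ℝ] F := fun y => P.comp (A y)
  have hQ : DifferentiableAt ℝ Q z := (differentiableAt_const P).clm_comp hA
  have hQz : Q z = (ContinuousLinearEquiv.refl ℝ F : F →L[ℝ] F) := hP
  have hinv : DifferentiableAt ℝ (fun y => (Q y).inverse) z := by
    have h1 : ContDiffAt ℝ 1 ContinuousLinearMap.inverse (Q z) := by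
      rw [hQz]
      exact contDiffAt_map_inverse _
    exact (h1.differentiableAt (by simp)).comp z hQ
  have hev : ∀ᶠ y in 𝓝 z, Q y ∈ range ((↑) : (F ≃L[ℝ] F) → F →L[ℝ] F) := by
    refine hQ.continuousAt.eventually_mem ?_
    rw [hQz]
    exact ContinuousLinearEquiv.nhds _
  refine (hinv.clm_apply ((differentiableAt_const P).clm_apply hR)).congr_of_eventuallyEq ?_
  filter_upwards [hev, h] with y ⟨e, he⟩ hy
  rw [← hy]
  have h2 : P (A y (Y y)) = e (Y y) := by
    rw [← ContinuousLinearEquiv.coe_coe, he]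
    rfl
  rw [h2, ← he, ContinuousLinearMap.inverse_equiv]
  exact (e.symm_apply_apply _).symm

theorem fderiv_apply_comm {G : E → E →L[ℝ] E →L[ℝ] ℝ} {z : E} (hG : DifferentiableAt ℝ G z)
    (hsymm : ∀ᶠ y in 𝓝 z, ∀ a b, G y a b = G y b a) (v x y : E) :
    fderiv ℝ G z v x y = fderiv ℝ G z v y x := by
  have h1 : ∀ x y, HasFDerivAt (fun q => G q x y) (((fderiv ℝ G z).flip x).flip y) z := by
    intro x y
    have := (hG.hasFDerivAt.clm_apply (hasFDerivAt_const x z)).clm_apply (hasFDerivAt_const y z)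
    refine this.congr_fderiv ?_
    ext v
    simp
  have h2 := (h1 x y).congr_of_eventuallyEq
    (f₁ := fun q => G q y x) (hsymm.mono fun q hq => hq y x)
  have h3 := DFunLike.congr_fun ((h1 y x).unique h2) v
  simpa using h3.symm

theorem christoffelForm_comm {G : E → E →L[ℝ] E →L[ℝ] ℝ} {z : E} (hG : DifferentiableAt ℝ G z)
    (hsymm : ∀ᶠ y in 𝓝 z, ∀ a b, G y a b = G y b a) (a b w : E) :
    christoffelForm G z a b w = christoffelForm G z b a w := by
  rw [christoffelForm_apply, christoffelForm_apply, fderiv_apply_comm hG hsymm w a b]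
  ring

/-- The second derivative of a composition. -/
theorem fderiv_fderiv_comp {H : Type*} [NormedAddCommGroup H] [NormedSpace ℝ H] {f : F → E}
    {j : H → F} {h : H → E} {x : H} (hf : ContDiffAt ℝ 2 f (j x)) (hj : ContDiffAt ℝ 2 j x)
    (hh : h =ᶠ[𝓝 x] fun y => f (j y)) (s t : H) :
    fderiv ℝ (fderiv ℝ h) x s t = fderiv ℝ (fderiv ℝ f) (j x) (fderiv ℝ j x s) (fderiv ℝ j x t) +
      fderiv ℝ f (j x) (fderiv ℝ (fderiv ℝ j) x s t) := by
  have hf' := ((hf.fderiv_right (m := 1) (by norm_num)).differentiableAt (by simp)).hasFDerivAt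
  have hj' := ((hj.fderiv_right (m := 1) (by norm_num)).differentiableAt (by simp)).hasFDerivAt
  have h1 : fderiv ℝ h =ᶠ[𝓝 x] fun y => (fderiv ℝ f (j y)).comp (fderiv ℝ j y) := by
    filter_upwards [hh.eventuallyEq_nhds, hj.eventually (by simp),
      hj.continuousAt.eventually (hf.eventually (by simp))] with y h2 h3 h4
    rw [h2.fderiv_eq]
    exact fderiv_comp y (h4.differentiableAt (by simp)) (h3.differentiableAt (by simp))
  have h2 := (hf'.comp x (hj.differentiableAt (by simp)).hasFDerivAt).clm_comp hj'
  rw [h1.fderiv_eq, show fderiv ℝ (fun y => (fderiv ℝ f (j y)).comp (fderiv ℝ j y)) x = _ from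
    h2.fderiv]
  simp [add_comm]

/-- The derivative of the pull-back of a one-form. -/
theorem fderiv_pullback {H : Type*} [NormedAddCommGroup H] [NormedSpace ℝ H]
    {T : F → F →L[ℝ] ℝ} {S : H → H →L[ℝ] ℝ} {j : H → F} {x : H}
    (hT : DifferentiableAt ℝ T (j x)) (hj : ContDiffAt ℝ 2 j x)
    (hS : S =ᶠ[𝓝 x] fun y => (T (j y)).comp (fderiv ℝ j y)) (s t : H) :
    fderiv ℝ S x s t = fderiv ℝ T (j x) (fderiv ℝ j x s) (fderiv ℝ j x t) +
      T (j x) (fderiv ℝ (fderiv ℝ j) x s t) := by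
  have hj' := ((hj.fderiv_right (m := 1) (by norm_num)).differentiableAt (by simp)).hasFDerivAt
  have h2 := (hT.hasFDerivAt.comp x (hj.differentiableAt (by simp)).hasFDerivAt).clm_comp hj'
  rw [hS.fderiv_eq, show fderiv ℝ (fun y => (T (j y)).comp (fderiv ℝ j y)) x = _ from h2.fderiv]
  simp [add_comm]

/-- In coordinates, the one-form dual to the vector field `X` of an immersed submanifold `f`. -/
noncomputable def dualForm (G : E → E →L[ℝ] E →L[ℝ] ℝ) (f : F → E) (X : F → F) (z : F) : F →L[ℝ] ℝ :=
  (G (f z) (fderiv ℝ f z (X z))).comp (fderiv ℝ f z)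

variable {f : F → E} {z₀ : F} {G : E → E →L[ℝ] E →L[ℝ] ℝ} {X : F → F}

theorem hasFDerivAt_fderiv_apply (hf : ContDiffAt ℝ 2 f z₀) (hX : DifferentiableAt ℝ X z₀) :
    HasFDerivAt (fun z => fderiv ℝ f z (X z)) ((fderiv ℝ f z₀).comp (fderiv ℝ X z₀) +
      (fderiv ℝ (fderiv ℝ f) z₀).flip (X z₀)) z₀ :=
  ((hf.fderiv_right (m := 1) (by norm_num)).differentiableAt
    (by simp)).hasFDerivAt.clm_apply hX.hasFDerivAt

theorem hasFDerivAt_dualForm_apply (hf : ContDiffAt ℝ 2 f z₀) (hG : DifferentiableAt ℝ G (f z₀))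
    (hX : DifferentiableAt ℝ X z₀) : DifferentiableAt ℝ (dualForm G f X) z₀ ∧ ∀ a b : F,
      fderiv ℝ (dualForm G f X) z₀ a b =
        fderiv ℝ G (f z₀) (fderiv ℝ f z₀ a) (fderiv ℝ f z₀ (X z₀)) (fderiv ℝ f z₀ b) +
        G (f z₀) (fderiv ℝ (fderiv ℝ f) z₀ a (X z₀) + fderiv ℝ f z₀ (fderiv ℝ X z₀ a))
          (fderiv ℝ f z₀ b) +
        G (f z₀) (fderiv ℝ f z₀ (X z₀)) (fderiv ℝ (fderiv ℝ f) z₀ a b) := by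
  have hf' : HasFDerivAt (fderiv ℝ f) (fderiv ℝ (fderiv ℝ f) z₀) z₀ :=
    ((hf.fderiv_right (m := 1) (by norm_num)).differentiableAt (by simp)).hasFDerivAt
  have h1 := HasFDerivAt.comp (g := G) (f := f) z₀ hG.hasFDerivAt (hf.differentiableAt (by simp)).hasFDerivAt
  have h2 := (h1.clm_apply (hasFDerivAt_fderiv_apply hf hX)).clm_comp hf'
  have h3 : HasFDerivAt (dualForm G f X) _ z₀ := h2
  refine ⟨h3.differentiableAt, fun a b => ?_⟩
  rw [h3.fderiv]
  simp
  ring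

/-- For a totally geodesic immersed submanifold with a complex structure `J` whose covariant
derivative has no component along `J` of the vectors considered, the derivative of the one-form
dual to a section `X` of the holomorphic distribution is given by the second covariant derivative
of the immersion. The reason is that `∇ X` is orthogonal to the totally real distribution: apply
`J` and use that `∇ (J X)` is tangent. -/
theorem fderiv_dualForm (hf : ContDiffAt ℝ 2 f z₀) (hG : DifferentiableAt ℝ G (f z₀))
    (hsymm : ∀ᶠ y in 𝓝 (f z₀), ∀ a b, G y a b = G y b a)
    {J : E → E →L[ℝ] E} (hJ : DifferentiableAt ℝ J (f z₀))
    (hcompat : ∀ a b, G (f z₀) (J (f z₀) a) (J (f z₀) b) = G (f z₀) a b)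
    {Y : F → F} (hX : DifferentiableAt ℝ X z₀) (hY : DifferentiableAt ℝ Y z₀)
    (hXY : ∀ᶠ z in 𝓝 z₀, J (f z) (fderiv ℝ f z (X z)) = fderiv ℝ f z (Y z))
    {Γ : E → E → E} (hΓ : ∀ a b w, G (f z₀) (Γ a b) w = christoffelForm G (f z₀) a b w)
    (hgeod : ∀ a b, ∃ c, fderiv ℝ (fderiv ℝ f) z₀ a b + Γ (fderiv ℝ f z₀ a) (fderiv ℝ f z₀ b) =
      fderiv ℝ f z₀ c)
    {a b : F} (hnormal : ∀ c, G (f z₀) (fderiv ℝ f z₀ c) (J (f z₀) (fderiv ℝ f z₀ b)) = 0)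
    (hK : G (f z₀) (fderiv ℝ J (f z₀) (fderiv ℝ f z₀ a) (fderiv ℝ f z₀ (X z₀)) +
      Γ (fderiv ℝ f z₀ a) (J (f z₀) (fderiv ℝ f z₀ (X z₀))) -
      J (f z₀) (Γ (fderiv ℝ f z₀ a) (fderiv ℝ f z₀ (X z₀)))) (J (f z₀) (fderiv ℝ f z₀ b)) = 0) :
    fderiv ℝ (dualForm G f X) z₀ a b = G (f z₀) (fderiv ℝ f z₀ (X z₀))
      (fderiv ℝ (fderiv ℝ f) z₀ a b + Γ (fderiv ℝ f z₀ a) (fderiv ℝ f z₀ b)) := by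
  have hsymm₀ := hsymm.self_of_nhds
  have hdsymm := fderiv_apply_comm hG hsymm
  have hJd := (hJ.hasFDerivAt.comp z₀ (hf.differentiableAt (by simp)).hasFDerivAt).clm_apply
    (hasFDerivAt_fderiv_apply hf hX)
  have hYd := (hasFDerivAt_fderiv_apply hf hY).congr_of_eventuallyEq hXY
  -- the derivative of `J (df X) = df Y` in the direction `a`
  have heq := DFunLike.congr_fun (HasFDerivAt.unique (f := fun z => J (f z) (fderiv ℝ f z (X z)))
    hJd hYd) a
  simp only [add_apply, ContinuousLinearMap.comp_apply,
    ContinuousLinearMap.flip_apply, Function.comp_apply] at heq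
  have hX0 := hXY.self_of_nhds
  obtain ⟨c, hc⟩ := hgeod a (Y z₀)
  have hperp : G (f z₀) (fderiv ℝ (fderiv ℝ f) z₀ a (X z₀) + fderiv ℝ f z₀ (fderiv ℝ X z₀ a) +
      Γ (fderiv ℝ f z₀ a) (fderiv ℝ f z₀ (X z₀))) (fderiv ℝ f z₀ b) = 0 := by
    rw [← hcompat, ← neg_eq_zero, ← hK, hX0]
    have h1 : fderiv ℝ J (f z₀) (fderiv ℝ f z₀ a) (fderiv ℝ f z₀ (X z₀)) +
        Γ (fderiv ℝ f z₀ a) (fderiv ℝ f z₀ (Y z₀)) -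
        J (f z₀) (Γ (fderiv ℝ f z₀ a) (fderiv ℝ f z₀ (X z₀))) =
        fderiv ℝ f z₀ (c + fderiv ℝ Y z₀ a) -
        J (f z₀) (fderiv ℝ (fderiv ℝ f) z₀ a (X z₀) + fderiv ℝ f z₀ (fderiv ℝ X z₀ a) +
          Γ (fderiv ℝ f z₀ a) (fderiv ℝ f z₀ (X z₀))) := by
      rw [map_add (fderiv ℝ f z₀), ← hc, map_add, map_add]
      rw [map_add] at heq
      have h2 : fderiv ℝ J (f z₀) (fderiv ℝ f z₀ a) (fderiv ℝ f z₀ (X z₀)) =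
        fderiv ℝ f z₀ (fderiv ℝ Y z₀ a) + fderiv ℝ (fderiv ℝ f) z₀ a (Y z₀) -
        (J (f z₀) (fderiv ℝ f z₀ (fderiv ℝ X z₀ a)) +
          J (f z₀) (fderiv ℝ (fderiv ℝ f) z₀ a (X z₀))) := by
        rw [← heq]
        abel
      rw [h2]
      abel
    rw [h1, map_sub, sub_apply, hnormal, zero_sub]
  rw [(hasFDerivAt_dualForm_apply hf hG hX).2]
  rw [map_add, add_apply, hΓ, christoffelForm_apply] at hperp
  rw [map_add (G (f z₀) (fderiv ℝ f z₀ (X z₀))), hsymm₀ _ (Γ _ _), hΓ, christoffelForm_apply]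
  have e1 := hdsymm (fderiv ℝ f z₀ a) (fderiv ℝ f z₀ (X z₀)) (fderiv ℝ f z₀ b)
  have e2 := hdsymm (fderiv ℝ f z₀ (X z₀)) (fderiv ℝ f z₀ a) (fderiv ℝ f z₀ b)
  have e3 := hdsymm (fderiv ℝ f z₀ b) (fderiv ℝ f z₀ a) (fderiv ℝ f z₀ (X z₀))
  linarith

end Coordinates
end LCK

/-! ### Geometric objects in charts -/

namespace LCK

open Filter Topology

section Charts

variable {E : Type*} [NormedAddCommGroup E] [NormedSpace ℝ E]
variable {M : Type*} [TopologicalSpace M] [ChartedSpace E M]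

/-- The differential at `q` of the preferred chart at `p`. -/
noncomputable def chartDiff (p q : M) : E →L[ℝ] E :=
  mfderiv 𝓘(ℝ, E) 𝓘(ℝ, E) (extChartAt 𝓘(ℝ, E) p) q

variable [IsManifold 𝓘(ℝ, E) ∞ M]

theorem chartDiff_self (p : M) : chartDiff p p = ContinuousLinearMap.id ℝ E :=
  have : IsManifold 𝓘(ℝ, E) 1 M := .of_le (n := ∞) (by simp)
  mfderiv_extChartAt_self

theorem chartDiff_coordFrame {p : M} {z : E} (hz : z ∈ (extChartAt 𝓘(ℝ, E) p).target) (v : E) :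
    chartDiff p ((extChartAt 𝓘(ℝ, E) p).symm z) (coordFrame p z v) = v := by
  have : IsManifold 𝓘(ℝ, E) 1 M := .of_le (n := ∞) (by simp)
  have h := mfderiv_extChartAt_comp_mfderivWithin_extChartAt_symm (I := 𝓘(ℝ, E)) hz
  rw [ModelWithCorners.range_eq_univ, mfderivWithin_univ] at h
  exact DFunLike.congr_fun h v

theorem coordFrame_chartDiff {p : M} {z : E} (hz : z ∈ (extChartAt 𝓘(ℝ, E) p).target) (v : E) :
    coordFrame p z (chartDiff p ((extChartAt 𝓘(ℝ, E) p).symm z) v) = v := by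
  have : IsManifold 𝓘(ℝ, E) 1 M := .of_le (n := ∞) (by simp)
  have h := mfderivWithin_extChartAt_symm_comp_mfderiv_extChartAt (I := 𝓘(ℝ, E)) hz
  rw [ModelWithCorners.range_eq_univ, mfderivWithin_univ] at h
  exact DFunLike.congr_fun h v

theorem coordFrame_self (p : M) :
    coordFrame p (extChartAt 𝓘(ℝ, E) p p) = ContinuousLinearMap.id ℝ E := by
  have : IsManifold 𝓘(ℝ, E) 1 M := .of_le (n := ∞) (by simp)
  have h := mfderivWithin_range_extChartAt_symm (I := 𝓘(ℝ, E)) (x := p)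
  rw [ModelWithCorners.range_eq_univ, mfderivWithin_univ] at h
  exact h

theorem metricInChart_self (g : BilinField E M) (p : M) (a b : E) :
    metricInChart g p (extChartAt 𝓘(ℝ, E) p p) a b =
      (show E →L[ℝ] E →L[ℝ] ℝ from g p) a b := by
  simp only [metricInChart, coordFrame_self]
  rw [extChartAt_to_inv]
  rfl

theorem endInChart_self (J : EndField E M) (p : M) (a : E) :
    endInChart J p (extChartAt 𝓘(ℝ, E) p p) a = (show E →L[ℝ] E from J p) a := by
  have h : ∀ q : M, q = p → (chartDiff p q).comp
      ((show E →L[ℝ] E from J q).comp (ContinuousLinearMap.id ℝ E)) = J p := by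
    rintro _ rfl
    rw [chartDiff_self]
    rfl
  have := h _ (extChartAt_to_inv (I := 𝓘(ℝ, E)) p)
  rw [← coordFrame_self p] at this
  exact DFunLike.congr_fun this a

/-- A map to the tangent bundle lying over the inverse of a chart is smooth if its coordinates in
that chart are. -/
theorem contMDiffOn_tangent_iff {p : M} {W : Set E} (hW : W ⊆ (extChartAt 𝓘(ℝ, E) p).target)
    {v : ∀ z : E, TangentSpace 𝓘(ℝ, E) ((extChartAt 𝓘(ℝ, E) p).symm z)} :
    ContMDiffOn 𝓘(ℝ, E) 𝓘(ℝ, E).tangent ∞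
      (fun z => (⟨(extChartAt 𝓘(ℝ, E) p).symm z, v z⟩ : TangentBundle 𝓘(ℝ, E) M)) W ↔
    ContDiffOn ℝ ∞ (fun z => chartDiff p ((extChartAt 𝓘(ℝ, E) p).symm z) (v z)) W := by
  have : IsManifold 𝓘(ℝ, E) 1 M := .of_le (n := ∞) (by simp)
  have hsrc : ∀ z ∈ W, (extChartAt 𝓘(ℝ, E) p).symm z ∈ (chartAt E p).source := by
    intro z hz
    rw [← extChartAt_source (I := 𝓘(ℝ, E))]
    exact (extChartAt 𝓘(ℝ, E) p).map_target (hW hz)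
  rw [(trivializationAt E (TangentSpace 𝓘(ℝ, E)) p).contMDiffOn_iff (IB := 𝓘(ℝ, E))
    (fun z hz => by
      rw [TangentBundle.trivializationAt_source]
      exact hsrc z hz), ← contMDiffOn_iff_contDiffOn]
  have h1 : ContMDiffOn 𝓘(ℝ, E) 𝓘(ℝ, E) ∞ (fun z => (extChartAt 𝓘(ℝ, E) p).symm z) W :=
    (contMDiffOn_extChartAt_symm p).mono hW
  rw [and_iff_right h1]
  refine contMDiffOn_congr fun z hz => ?_
  have h2 := TangentBundle.continuousLinearMapAt_trivializationAt (I := 𝓘(ℝ, E)) (hsrc z hz)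
  refine Eq.trans ?_ (DFunLike.congr_fun h2 (v z))
  rw [Trivialization.continuousLinearMapAt_apply, Trivialization.coe_linearMapAt_of_mem _
    (by rw [TangentBundle.trivializationAt_baseSet]; exact hsrc z hz)]

theorem coordFrame_chartDiff' {p q : M} (hq : q ∈ (extChartAt 𝓘(ℝ, E) p).source) (v : E) :
    coordFrame p (extChartAt 𝓘(ℝ, E) p q) (chartDiff p q v) = v := by
  have h := coordFrame_chartDiff ((extChartAt 𝓘(ℝ, E) p).map_source hq) v
  rwa [(extChartAt 𝓘(ℝ, E) p).left_inv hq] at h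

theorem contMDiffOn_coordFrame (p : M) (a : E) :
    ContMDiffOn 𝓘(ℝ, E) 𝓘(ℝ, E).tangent ∞
      (fun z => (⟨(extChartAt 𝓘(ℝ, E) p).symm z, coordFrame p z a⟩ : TangentBundle 𝓘(ℝ, E) M))
      (extChartAt 𝓘(ℝ, E) p).target :=
  (contMDiffOn_tangent_iff Subset.rfl).2
    (contDiffOn_const.congr fun _ hz => chartDiff_coordFrame hz a)

/-- A smooth vector field has smooth coordinates in a chart. -/
theorem contDiffOn_chartDiff {X : ∀ q : M, TangentSpace 𝓘(ℝ, E) q} {V : Set M}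
    (hX : ContMDiffOn 𝓘(ℝ, E) 𝓘(ℝ, E).tangent ∞
      (fun q => (⟨q, X q⟩ : TangentBundle 𝓘(ℝ, E) M)) V) (p : M) :
    ContDiffOn ℝ ∞ (fun z => chartDiff p ((extChartAt 𝓘(ℝ, E) p).symm z)
      (X ((extChartAt 𝓘(ℝ, E) p).symm z)))
      ((extChartAt 𝓘(ℝ, E) p).target ∩ (extChartAt 𝓘(ℝ, E) p).symm ⁻¹' V) := by
  rw [← contMDiffOn_tangent_iff inter_subset_left]
  exact hX.comp ((contMDiffOn_extChartAt_symm p).mono inter_subset_left) fun z hz => hz.2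

theorem contDiffOn_metricInChart [FiniteDimensional ℝ E] (g : Metric E M) (p : M) :
    ContDiffOn ℝ ∞ (metricInChart g.inner p) (extChartAt 𝓘(ℝ, E) p).target := by
  rw [contDiffOn_clm_apply]
  intro a
  rw [contDiffOn_clm_apply]
  intro b z hz
  have hg := g.contMDiff.contMDiffAt.comp_contMDiffWithinAt z (contMDiffOn_extChartAt_symm p z hz)
  have h : ContMDiffWithinAt 𝓘(ℝ, E) (𝓘(ℝ, E).prod 𝓘(ℝ)) ∞
      (fun z => TotalSpace.mk' ℝ (E := Bundle.Trivial M ℝ) ((extChartAt 𝓘(ℝ, E) p).symm z)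
        (g.inner ((extChartAt 𝓘(ℝ, E) p).symm z) (coordFrame p z a) (coordFrame p z b)))
      (extChartAt 𝓘(ℝ, E) p).target z := by
    apply ContMDiffWithinAt.clm_bundle_apply₂ (F₁ := E) (F₂ := E)
    · exact hg
    · exact contMDiffOn_coordFrame p a z hz
    · exact contMDiffOn_coordFrame p b z hz
  rw [contMDiffWithinAt_totalSpace] at h
  exact h.2.contDiffWithinAt

theorem contDiffOn_endInChart [FiniteDimensional ℝ E] {g : Metric E M} {J : EndField E M}
    (hJ : IsAlmostHermitian g J) (p : M) :
    ContDiffOn ℝ ∞ (endInChart J p) (extChartAt 𝓘(ℝ, E) p).target := by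
  rw [contDiffOn_clm_apply]
  intro a
  refine (contMDiffOn_tangent_iff (M := M) (p := p) Subset.rfl
    (v := fun z => J _ (coordFrame p z a))).1 fun z hz => ?_
  have h := hJ.smooth.contMDiffAt.comp_contMDiffWithinAt z (contMDiffOn_extChartAt_symm p z hz)
  exact ContMDiffWithinAt.clm_bundle_apply (F₁ := E) (F₂ := E) h (contMDiffOn_coordFrame p a z hz)

end Charts

section Maps

variable {E : Type*} [NormedAddCommGroup E] [NormedSpace ℝ E]
variable {M : Type*} [TopologicalSpace M] [ChartedSpace E M]
variable {F : Type*} [NormedAddCommGroup F] [NormedSpace ℝ F]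
variable {N : Type*} [TopologicalSpace N] [ChartedSpace F N]

/-- The map `ι` in the preferred charts at `q` and `p`. -/
noncomputable def inCharts (ι : N → M) (q : N) (p : M) (z : F) : E :=
  extChartAt 𝓘(ℝ, E) p (ι ((extChartAt 𝓘(ℝ, F) q).symm z))

/-- The domain on which `ι` can be written in the preferred charts at `q` and `p`. -/
def chartsDomain (E F : Type*) [NormedAddCommGroup E] [NormedSpace ℝ E]
    [NormedAddCommGroup F] [NormedSpace ℝ F] [ChartedSpace E M] [ChartedSpace F N]
    (ι : N → M) (q : N) (p : M) : Set F :=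
  (extChartAt 𝓘(ℝ, F) q).target ∩
    (extChartAt 𝓘(ℝ, F) q).symm ⁻¹' (ι ⁻¹' (extChartAt 𝓘(ℝ, E) p).source)

theorem isOpen_preimage_extChartAt_symm {V : Set N} (hV : IsOpen V) (q : N) :
    IsOpen ((extChartAt 𝓘(ℝ, F) q).target ∩ (extChartAt 𝓘(ℝ, F) q).symm ⁻¹' V) :=
  (continuousOn_extChartAt_symm q).isOpen_inter_preimage (isOpen_extChartAt_target q) hV

theorem isOpen_chartsDomain {ι : N → M} (hι : Continuous ι) (q : N) (p : M) :
    IsOpen (chartsDomain E F ι q p) :=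
  isOpen_preimage_extChartAt_symm ((isOpen_extChartAt_source p).preimage hι) q

theorem mem_chartsDomain {ι : N → M} {q : N} {p : M} {x : N}
    (hx : x ∈ (extChartAt 𝓘(ℝ, F) q).source) (hι : ι x ∈ (extChartAt 𝓘(ℝ, E) p).source) :
    extChartAt 𝓘(ℝ, F) q x ∈ chartsDomain E F ι q p := by
  refine ⟨(extChartAt 𝓘(ℝ, F) q).map_source hx, ?_⟩
  rw [mem_preimage, (extChartAt 𝓘(ℝ, F) q).left_inv hx]
  exact hι

variable [IsManifold 𝓘(ℝ, E) ∞ M] [IsManifold 𝓘(ℝ, F) ∞ N]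

theorem contDiffOn_inCharts {ι : N → M} (hι : ContMDiff 𝓘(ℝ, F) 𝓘(ℝ, E) ∞ ι) (q : N) (p : M) :
    ContDiffOn ℝ ∞ (inCharts (E := E) (F := F) ι q p) (chartsDomain E F ι q p) := by
  rw [← contMDiffOn_iff_contDiffOn]
  exact ((contMDiffOn_extChartAt (I := 𝓘(ℝ, E)) (x := p)).comp hι.contMDiffOn
    (fun x hx => hx)).comp
    ((contMDiffOn_extChartAt_symm (I := 𝓘(ℝ, F)) q).mono inter_subset_left) fun z hz => by
      simpa [chartsDomain] using hz.2

theorem fderiv_inCharts {ι : N → M} (hι : ContMDiff 𝓘(ℝ, F) 𝓘(ℝ, E) ∞ ι) {q : N} {p : M}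
    {z : F} (hz : z ∈ chartsDomain E F ι q p) (v : F) :
    fderiv ℝ (inCharts (E := E) (F := F) ι q p) z v =
      chartDiff (E := E) p (ι ((extChartAt 𝓘(ℝ, F) q).symm z))
        (differential (E := E) (F := F) ι ((extChartAt 𝓘(ℝ, F) q).symm z) (coordFrame q z v)) := by
  have : IsManifold 𝓘(ℝ, E) 1 M := .of_le (n := ∞) (by simp)
  have : IsManifold 𝓘(ℝ, F) 1 N := .of_le (n := ∞) (by simp)
  have h1 : MDifferentiableAt 𝓘(ℝ, F) 𝓘(ℝ, F) (extChartAt 𝓘(ℝ, F) q).symm z :=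
    ((contMDiffOn_extChartAt_symm (I := 𝓘(ℝ, F)) (n := ∞) q).contMDiffAt
      ((isOpen_extChartAt_target q).mem_nhds hz.1)).mdifferentiableAt (by simp)
  have h2 : MDifferentiableAt 𝓘(ℝ, F) 𝓘(ℝ, E) ι ((extChartAt 𝓘(ℝ, F) q).symm z) :=
    hι.contMDiffAt.mdifferentiableAt (by simp)
  have h3 : MDifferentiableAt 𝓘(ℝ, E) 𝓘(ℝ, E) (extChartAt 𝓘(ℝ, E) p)
      (ι ((extChartAt 𝓘(ℝ, F) q).symm z)) :=
    mdifferentiableAt_extChartAt (by rw [← extChartAt_source (I := 𝓘(ℝ, E))]; exact hz.2)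
  have h4 := mfderiv_comp z h3 (h2.comp z h1)
  rw [mfderiv_comp z h2 h1, mfderiv_eq_fderiv] at h4
  exact DFunLike.congr_fun h4 v

/-- The differential of `ι` in terms of the coordinate frames of two charts. -/
theorem differential_coordFrame {ι : N → M} (hι : ContMDiff 𝓘(ℝ, F) 𝓘(ℝ, E) ∞ ι) {q : N} {p : M}
    {z : F} (hz : z ∈ chartsDomain E F ι q p) (v : F) :
    (differential (E := E) (F := F) ι ((extChartAt 𝓘(ℝ, F) q).symm z) (coordFrame q z v) : E) =
      coordFrame p (inCharts (E := E) (F := F) ι q p z)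
        (fderiv ℝ (inCharts (E := E) (F := F) ι q p) z v) := by
  rw [fderiv_inCharts hι hz]
  exact (coordFrame_chartDiff' hz.2 _).symm

theorem fderiv_inCharts_self {ι : N → M} (hι : ContMDiff 𝓘(ℝ, F) 𝓘(ℝ, E) ∞ ι) (q : N) (v : F) :
    fderiv ℝ (inCharts (E := E) (F := F) ι q (ι q)) (extChartAt 𝓘(ℝ, F) q q) v =
      differential (E := E) (F := F) ι q v := by
  rw [fderiv_inCharts hι (mem_chartsDomain (mem_extChartAt_source q) (mem_extChartAt_source _)),
    coordFrame_self, extChartAt_to_inv, chartDiff_self]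
  rfl

end Maps
end LCK

/-! ### The Kähler condition -/

noncomputable section

namespace LCK

open Filter Topology

section ModelSpace

variable {E : Type*} [NormedAddCommGroup E] [NormedSpace ℝ E]
variable {M : Type*} [TopologicalSpace M] [ChartedSpace E M]

/-- The bilinear form `g p`, on the model space. -/
def bilinAt (g : BilinField E M) (p : M) : E →L[ℝ] E →L[ℝ] ℝ := g p

/-- The endomorphism `J p`, on the model space. -/
def endAt (J : EndField E M) (p : M) : E →L[ℝ] E := J p

/-- The covector `lee p`, on the model space. -/
def covectorAt (lee : OneForm E M) (p : M) : E →L[ℝ] ℝ := lee p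

/-- The Christoffel symbols at `p`, on the model space. -/
def christoffelAt (g : BilinField E M) (p : M) (a b : E) : E := christoffel g p a b

variable [IsManifold 𝓘(ℝ, E) ∞ M]

theorem bilinAt_comm (g : Metric E M) (p : M) (a b : E) :
    bilinAt g.inner p a b = bilinAt g.inner p b a :=
  g.symm p a b

theorem bilinAt_pos (g : Metric E M) (p : M) (a : E) (ha : a ≠ 0) : 0 < bilinAt g.inner p a a :=
  g.pos p a ha

theorem eventually_metricInChart_comm (g : Metric E M) (p : M) (y : E) :
    ∀ᶠ z in 𝓝 y, ∀ a b, metricInChart g.inner p z a b = metricInChart g.inner p z b a :=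
  Eventually.of_forall fun z a b => bilinAt_comm g _ (coordFrame p z a) (coordFrame p z b)

end ModelSpace

section Kahler

variable {E : Type*} [NormedAddCommGroup E] [NormedSpace ℝ E] [FiniteDimensional ℝ E]
variable {M : Type*} [TopologicalSpace M] [ChartedSpace E M] [IsManifold 𝓘(ℝ, E) ∞ M]

set_option synthInstance.maxHeartbeats 200000

theorem metricInChart_differentiableAt (g : Metric E M) (p : M) :
    DifferentiableAt ℝ (metricInChart g.inner p) (extChartAt 𝓘(ℝ, E) p p) :=
  ((contDiffOn_metricInChart g p).contDiffAt ((isOpen_extChartAt_target p).mem_nhds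
    (mem_extChartAt_target p))).differentiableAt (by simp)

theorem bilinAt_christoffelAt (g : Metric E M) (p : M) (a b w : E) :
    bilinAt g.inner p (christoffelAt g.inner p a b) w =
      christoffelForm (metricInChart g.inner p) (extChartAt 𝓘(ℝ, E) p p) a b w :=
  apply_sharp (E := E) (bilinAt g.inner p) (bilinAt_pos g p) _ w

/-- The Levi-Civita connections of `g` and `exp (-c) g`, where `dc = η` at `p`. -/
theorem bilinAt_christoffelAt_conformal (g : Metric E M) {c : M → ℝ} {p : M}
    (hc : MDifferentiableAt 𝓘(ℝ, E) 𝓘(ℝ, ℝ) c p) {η : E →L[ℝ] ℝ}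
    (hη : ∀ v : TangentSpace 𝓘(ℝ, E) p, η v = (mfderiv 𝓘(ℝ, E) 𝓘(ℝ, ℝ) c p v : ℝ)) (a b w : E) :
    bilinAt g.inner p (christoffelAt (conformal c g.inner) p a b) w =
      bilinAt g.inner p (christoffelAt g.inner p a b) w -
        (1 / 2) * (η a * bilinAt g.inner p b w + η b * bilinAt g.inner p a w -
          η w * bilinAt g.inner p a b) := by
  have h1 : Real.exp (-c p) * bilinAt g.inner p (christoffelAt (conformal c g.inner) p a b) w =
      christoffelForm (metricInChart (conformal c g.inner) p) (extChartAt 𝓘(ℝ, E) p p) a b w :=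
    apply_sharp (E := E) (bilinAt (conformal c g.inner) p)
      (fun v hv => mul_pos (Real.exp_pos _) (bilinAt_pos g p v hv)) _ w
  have h2 : metricInChart (conformal c g.inner) p = fun z =>
      Real.exp (-c ((extChartAt 𝓘(ℝ, E) p).symm z)) • metricInChart g.inner p z := rfl
  have hc' : DifferentiableAt ℝ (fun z => c ((extChartAt 𝓘(ℝ, E) p).symm z))
      (extChartAt 𝓘(ℝ, E) p p) := by
    have := hc.differentiableWithinAt_writtenInExtChartAt
    rw [ModelWithCorners.range_eq_univ, differentiableWithinAt_univ] at this
    exact this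
  have h3 : fderiv ℝ (fun z => c ((extChartAt 𝓘(ℝ, E) p).symm z)) (extChartAt 𝓘(ℝ, E) p p) = η := by
    ext1 v
    refine Eq.trans ?_ (hη v).symm
    have h4 := hc.mfderiv
    rw [ModelWithCorners.range_eq_univ, fderivWithin_univ] at h4
    exact (DFunLike.congr_fun h4 v).symm
  have h4 : ∀ x y, metricInChart g.inner p (extChartAt 𝓘(ℝ, E) p p) x y =
      bilinAt g.inner p x y := metricInChart_self g.inner p
  rw [h2, christoffelForm_conformal (metricInChart_differentiableAt g p) hc',
    extChartAt_to_inv, h3, h4, h4, h4] at h1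
  rw [bilinAt_christoffelAt]
  exact mul_left_cancel₀ (Real.exp_pos _).ne' h1

/-- On a locally conformal Kähler manifold, the terms of `∇ J` that come from the Lee form have no
component along `J w` in the situation of a CR-submanifold with normal Lee field: `b` holomorphic,
`a` and `w` totally real. -/
theorem bilinAt_covDerivEnd_eq_zero {g : Metric E M} {J : EndField E M} {lee : OneForm E M}
    (hJ : IsAlmostHermitian g J) (hlee : IsLeeForm g J lee) {p : M} {a b w : E}
    (hb : covectorAt lee p b = 0)
    (hJb : covectorAt lee p (endAt J p b) = 0)
    (hbw : bilinAt g.inner p b w = 0) (hab : bilinAt g.inner p a b = 0)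
    (haJb : bilinAt g.inner p a (endAt J p b) = 0) :
    bilinAt g.inner p (fderiv ℝ (endInChart J p) (extChartAt 𝓘(ℝ, E) p p) a b +
      christoffelAt g.inner p a (endAt J p b) - endAt J p (christoffelAt g.inner p a b))
      (endAt J p w) = 0 := by
  obtain ⟨U, c, hpU, ⟨hU, hc, hK⟩, hlc⟩ := hlee p
  have hcd : MDifferentiableAt 𝓘(ℝ, E) 𝓘(ℝ, ℝ) c p :=
    (hc.contMDiffAt (hU.mem_nhds hpU)).mdifferentiableAt (by simp)
  have h : fderiv ℝ (endInChart J p) (extChartAt 𝓘(ℝ, E) p p) a b +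
      christoffelAt (conformal c g.inner) p a (endAt J p b) -
      endAt J p (christoffelAt (conformal c g.inner) p a b) = 0 := hK p hpU a b
  have hcompat : ∀ x y, bilinAt g.inner p (endAt J p x) (endAt J p y) = bilinAt g.inner p x y :=
    hJ.compat p
  have hΓ := bilinAt_christoffelAt_conformal g hcd (η := covectorAt lee p) (hlc p hpU)
  have h1 := congrArg (fun x => bilinAt g.inner p x (endAt J p w)) h
  simp only [map_add, map_sub, add_apply, sub_apply, hcompat, hΓ, hb, hJb, hbw, hab, haJb,
    map_zero, zero_apply] at h1 ⊢
  linarith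

end Kahler
end LCK

end

/-! ### Immersed submanifolds in charts -/

noncomputable section

namespace LCK

open Filter Topology

section Submanifold

variable {E : Type*} [NormedAddCommGroup E] [NormedSpace ℝ E]
variable {M : Type*} [TopologicalSpace M] [ChartedSpace E M]
variable {F : Type*} [NormedAddCommGroup F] [NormedSpace ℝ F]
variable {N : Type*} [TopologicalSpace N] [ChartedSpace F N]

set_option synthInstance.maxHeartbeats 200000

/-- The differential of `ι` at `q`, on the model spaces. -/
def diffAt (E F : Type*) [NormedAddCommGroup E] [NormedSpace ℝ E] [NormedAddCommGroup F]
    [NormedSpace ℝ F] [ChartedSpace E M] [ChartedSpace F N] (ι : N → M) (q : N) : F →L[ℝ] E :=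
  differential (E := E) (F := F) ι q

/-- The second covariant derivative of `ι` at `q`, on the model spaces. -/
def secondDerivAt (F : Type*) [NormedAddCommGroup F] [NormedSpace ℝ F] [ChartedSpace F N]
    (g : BilinField E M) (ι : N → M) (q : N) (a b : F) : E :=
  fderiv ℝ (fderiv ℝ (inCharts (E := E) (F := F) ι q (ι q))) (extChartAt 𝓘(ℝ, F) q q) a b +
    christoffelAt g (ι q) (diffAt E F ι q a) (diffAt E F ι q b)

/-- The coordinates of the vector field `X` in the preferred chart at `q`. -/
def vecInChart (X : ∀ q : N, TangentSpace 𝓘(ℝ, F) q) (q : N) (z : F) : F :=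
  chartDiff q ((extChartAt 𝓘(ℝ, F) q).symm z) (X ((extChartAt 𝓘(ℝ, F) q).symm z))

/-- The one-form on `N` dual to the vector field `X` for the metric induced by `ι`, in the preferred
chart at `q`. -/
def chartDualForm (g : BilinField E M) (ι : N → M) (X : ∀ q : N, TangentSpace 𝓘(ℝ, F) q) (q : N) :
    F → F →L[ℝ] ℝ :=
  dualForm (metricInChart g (ι q)) (inCharts ι q (ι q)) (vecInChart X q)

theorem inCharts_self (ι : N → M) (q : N) (p : M) :
    inCharts (E := E) (F := F) ι q p (extChartAt 𝓘(ℝ, F) q q) = extChartAt 𝓘(ℝ, E) p (ι q) := by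
  rw [inCharts, extChartAt_to_inv]

theorem metricInChart_apply (g : BilinField E M) {p q : M}
    (hq : q ∈ (extChartAt 𝓘(ℝ, E) p).source) (a b : E) :
    metricInChart g p (extChartAt 𝓘(ℝ, E) p q) a b =
      bilinAt g q (coordFrame p (extChartAt 𝓘(ℝ, E) p q) a)
        (coordFrame p (extChartAt 𝓘(ℝ, E) p q) b) := by
  have h : ∀ q' z, q' = q → (bilinAt g q').bilinearComp (coordFrame p z) (coordFrame p z) a b =
      bilinAt g q (coordFrame p z a) (coordFrame p z b) := by
    rintro _ _ rfl
    rfl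
  exact h _ _ ((extChartAt 𝓘(ℝ, E) p).left_inv hq)

theorem endInChart_apply (J : EndField E M) {p q : M}
    (hq : q ∈ (extChartAt 𝓘(ℝ, E) p).source) (a : E) :
    endInChart J p (extChartAt 𝓘(ℝ, E) p q) a =
      chartDiff p q (endAt J q (coordFrame p (extChartAt 𝓘(ℝ, E) p q) a)) := by
  have h : ∀ q' z, q' = q → chartDiff p q' (endAt J q' (coordFrame p z a)) =
      chartDiff p q (endAt J q (coordFrame p z a)) := by
    rintro _ _ rfl
    rfl
  exact h _ _ ((extChartAt 𝓘(ℝ, E) p).left_inv hq)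

theorem mem_tangentImage_iff {ι : N → M} {q : N} {x : E} :
    x ∈ tangentImage (E := E) (F := F) ι q ↔ ∃ v, x = diffAt E F ι q v :=
  ⟨fun ⟨v, hv⟩ => ⟨v, hv.symm⟩, fun ⟨v, hv⟩ => ⟨v, hv.symm⟩⟩

variable [IsManifold 𝓘(ℝ, E) ∞ M]

theorem isTotallyGeodesic_iff [FiniteDimensional ℝ E] (g : Metric E M) (ι : N → M) :
    IsTotallyGeodesic (F := F) g ι ↔
      ∀ (q : N) (a b : F), ∃ c, secondDerivAt F g.inner ι q a b = diffAt E F ι q c :=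
  forall₃_congr fun q _ _ =>
    (normalPart_eq_zero_iff (F := F) g ι q _).trans (mem_tangentImage_iff (E := E) (F := F))

theorem mem_perp_iff [FiniteDimensional ℝ E] {g : Metric E M} {ι : N → M} {D : SubspaceField F N}
    {q : N} {v : F} :
    v ∈ perp g ι D q ↔ ∀ d : F, d ∈ D q →
      bilinAt g.inner (ι q) (diffAt E F ι q v) (diffAt E F ι q d) = 0 :=
  ⟨fun h d hd => h _ ⟨d, hd, rfl⟩, by rintro h _ ⟨d, hd, rfl⟩; exact h d hd⟩

variable [IsManifold 𝓘(ℝ, F) ∞ N]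

theorem vecInChart_self (X : ∀ q : N, TangentSpace 𝓘(ℝ, F) q) (q : N) :
    vecInChart X q (extChartAt 𝓘(ℝ, F) q q) = (show F from X q) := by
  have h : ∀ q', q' = q → chartDiff (E := F) q q' (X q') = (show F from X q) := by
    rintro _ rfl
    rw [chartDiff_self]
    rfl
  exact h _ (extChartAt_to_inv q)

theorem coordFrame_vecInChart (X : ∀ q : N, TangentSpace 𝓘(ℝ, F) q) {q : N} {z : F}
    (hz : z ∈ (extChartAt 𝓘(ℝ, F) q).target) :
    coordFrame q z (vecInChart X q z) = (show F from X ((extChartAt 𝓘(ℝ, F) q).symm z)) :=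
  coordFrame_chartDiff hz _

theorem diffAt_coordFrame {ι : N → M} (hι : ContMDiff 𝓘(ℝ, F) 𝓘(ℝ, E) ∞ ι) {q : N} {p : M}
    {z : F} (hz : z ∈ chartsDomain E F ι q p) (v : F) :
    diffAt E F ι ((extChartAt 𝓘(ℝ, F) q).symm z) (coordFrame q z v) =
      coordFrame p (inCharts (E := E) (F := F) ι q p z)
        (fderiv ℝ (inCharts (E := E) (F := F) ι q p) z v) :=
  differential_coordFrame hι hz v

theorem fderiv_inCharts_eq_diffAt {ι : N → M} (hι : ContMDiff 𝓘(ℝ, F) 𝓘(ℝ, E) ∞ ι) (q : N) :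
    fderiv ℝ (inCharts (E := E) (F := F) ι q (ι q)) (extChartAt 𝓘(ℝ, F) q q) = diffAt E F ι q :=
  ContinuousLinearMap.ext (fderiv_inCharts_self hι q)

theorem contDiffAt_inCharts {ι : N → M} (hι : ContMDiff 𝓘(ℝ, F) 𝓘(ℝ, E) ∞ ι) {q : N} {p : M}
    {z : F} (hz : z ∈ chartsDomain E F ι q p) :
    ContDiffAt ℝ ∞ (inCharts (E := E) (F := F) ι q p) z :=
  (contDiffOn_inCharts hι q p).contDiffAt ((isOpen_chartsDomain hι.continuous q p).mem_nhds hz)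

/-- The one-form dual to `X`, evaluated through the coordinate frame. -/
theorem chartDualForm_apply (g : BilinField E M) {ι : N → M}
    (hι : ContMDiff 𝓘(ℝ, F) 𝓘(ℝ, E) ∞ ι) (X : ∀ q : N, TangentSpace 𝓘(ℝ, F) q) {q : N} {z : F}
    (hz : z ∈ chartsDomain E F ι q (ι q)) (v : F) :
    chartDualForm g ι X q z v = bilinAt g (ι ((extChartAt 𝓘(ℝ, F) q).symm z))
      (diffAt E F ι ((extChartAt 𝓘(ℝ, F) q).symm z) (X ((extChartAt 𝓘(ℝ, F) q).symm z)))
      (diffAt E F ι ((extChartAt 𝓘(ℝ, F) q).symm z) (coordFrame q z v)) := by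
  have h := metricInChart_apply g hz.2 (fderiv ℝ (inCharts (E := E) (F := F) ι q (ι q)) z
    (vecInChart X q z)) (fderiv ℝ (inCharts (E := E) (F := F) ι q (ι q)) z v)
  have h1 := diffAt_coordFrame hι hz v
  have h2 := diffAt_coordFrame hι hz (vecInChart X q z)
  rw [coordFrame_vecInChart X hz.1] at h2
  rw [inCharts] at h1 h2
  rw [← h1, ← h2] at h
  exact h

theorem contDiffOn_chartDualForm [FiniteDimensional ℝ E] (g : Metric E M) {ι : N → M}
    (hι : ContMDiff 𝓘(ℝ, F) 𝓘(ℝ, E) ∞ ι) {X : ∀ q : N, TangentSpace 𝓘(ℝ, F) q} {V : Set N}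
    (hX : ContMDiffOn 𝓘(ℝ, F) 𝓘(ℝ, F).tangent ∞
      (fun q => (⟨q, X q⟩ : TangentBundle 𝓘(ℝ, F) N)) V) (q : N) :
    ContDiffOn ℝ ∞ (chartDualForm g.inner ι X q) (chartsDomain E F ι q (ι q) ∩
      ((extChartAt 𝓘(ℝ, F) q).target ∩ (extChartAt 𝓘(ℝ, F) q).symm ⁻¹' V)) := by
  have hf := contDiffOn_inCharts (E := E) (F := F) hι q (ι q)
  have hf' : ContDiffOn ℝ ∞ (fderiv ℝ (inCharts (E := E) (F := F) ι q (ι q)))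
      (chartsDomain E F ι q (ι q)) :=
    hf.fderiv_of_isOpen (isOpen_chartsDomain hι.continuous q (ι q)) (by simp)
  have hG : ContDiffOn ℝ ∞ (fun z => metricInChart g.inner (ι q)
      (inCharts (E := E) (F := F) ι q (ι q) z)) (chartsDomain E F ι q (ι q)) :=
    (contDiffOn_metricInChart g (ι q)).comp hf fun z hz =>
      (extChartAt 𝓘(ℝ, E) (ι q)).map_source hz.2
  have h1 := (hf'.mono inter_subset_left).clm_apply
    ((contDiffOn_chartDiff hX q).mono (inter_subset_right (s := chartsDomain E F ι q (ι q))))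
  exact ((hG.mono inter_subset_left).clm_apply h1).clm_comp (hf'.mono inter_subset_left)

end Submanifold

end LCK

end

/-! ### One-forms dual to the holomorphic distribution -/

noncomputable section

namespace LCK

open Filter Topology

section Key

variable {E : Type*} [NormedAddCommGroup E] [NormedSpace ℝ E] [FiniteDimensional ℝ E]
variable {M : Type*} [TopologicalSpace M] [ChartedSpace E M] [IsManifold 𝓘(ℝ, E) ∞ M]
variable {F : Type*} [NormedAddCommGroup F] [NormedSpace ℝ F]
variable {N : Type*} [TopologicalSpace N] [ChartedSpace F N]

set_option synthInstance.maxHeartbeats 200000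

variable {g : Metric E M} {J : EndField E M} {lee : OneForm E M} {ι : N → M}
  {D : SubspaceField F N}

theorem covectorAt_diffAt_eq_zero {q : N}
    (hB : leeField g lee (ι q) ∈ orthogonal g (ι q) (tangentImage (F := F) ι q)) (v : F) :
    covectorAt lee (ι q) (diffAt E F ι q v) = 0 := by
  have h : bilinAt g.inner (ι q) (sharp (bilinAt g.inner (ι q)) (covectorAt lee (ι q)))
    (diffAt E F ι q v) = 0 := hB _ ⟨v, rfl⟩
  rwa [apply_sharp _ (bilinAt_pos g (ι q))] at h

variable [FiniteDimensional ℝ F] [IsManifold 𝓘(ℝ, F) ∞ N]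

/-- For a totally geodesic CR-submanifold with normal Lee field, the derivative of the one-form dual
to a section `X` of the holomorphic distribution, on totally real vectors `a` and `b`, is the
component along `X` of the covariant derivative `∇_a b`. -/
theorem fderiv_chartDualForm (hJ : IsAlmostHermitian g J) (hlee : IsLeeForm g J lee)
    (hCR : IsCRSubmanifold g J ι D)
    (hB : ∀ q, leeField g lee (ι q) ∈ orthogonal g (ι q) (tangentImage (F := F) ι q))
    (hgeod : IsTotallyGeodesic (F := F) g ι) {V : Set N} (hV : IsOpen V)
    {X : ∀ q : N, TangentSpace 𝓘(ℝ, F) q}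
    (hX : ContMDiffOn 𝓘(ℝ, F) 𝓘(ℝ, F).tangent ∞
      (fun q => (⟨q, X q⟩ : TangentBundle 𝓘(ℝ, F) N)) V)
    (hXD : ∀ q ∈ V, X q ∈ D q) {q : N} (hq : q ∈ V) {a b : F}
    (ha : a ∈ perp g ι D q) (hb : b ∈ perp g ι D q) :
    fderiv ℝ (chartDualForm g.inner ι X q) (extChartAt 𝓘(ℝ, F) q q) a b =
      bilinAt g.inner (ι q) (diffAt E F ι q (X q)) (secondDerivAt F g.inner ι q a b) := by
  have hι := hCR.immersion.1
  -- the vector field `J X`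
  have hYex : ∀ x : N, ∃ y : F, x ∈ V → y ∈ D x ∧
      endAt J (ι x) (diffAt E F ι x (X x)) = diffAt E F ι x y := by
    intro x
    by_cases hx : x ∈ V
    swap
    · exact ⟨0, fun h => absurd h hx⟩
    have h1 : endAt J (ι x) (diffAt E F ι x (X x)) ∈
        ((D x).map (differential (E := E) ι x).toLinearMap).map (J (ι x)).toLinearMap :=
      ⟨_, ⟨_, hXD x hx, rfl⟩, rfl⟩
    rw [hCR.holomorphic x] at h1
    obtain ⟨y, hy, hy'⟩ := h1
    exact ⟨y, fun _ => ⟨hy, hy'.symm⟩⟩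
  choose Y hY using hYex
  set z₀ := extChartAt 𝓘(ℝ, F) q q with hz₀
  set f := inCharts (E := E) (F := F) ι q (ι q) with hf_def
  have hz₀d : z₀ ∈ chartsDomain E F ι q (ι q) :=
    mem_chartsDomain (mem_extChartAt_source q) (mem_extChartAt_source _)
  have hfz : f z₀ = extChartAt 𝓘(ℝ, E) (ι q) (ι q) := inCharts_self ι q (ι q)
  have hf : ContDiffAt ℝ ∞ f z₀ := contDiffAt_inCharts hι hz₀d
  have hf2 : ContDiffAt ℝ 2 f z₀ := contDiffAt_infty.1 hf 2
  have hf' : fderiv ℝ f z₀ = diffAt E F ι q := fderiv_inCharts_eq_diffAt hι q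
  have hVq : ∀ᶠ z in 𝓝 z₀, z ∈ (extChartAt 𝓘(ℝ, F) q).target ∩
      (extChartAt 𝓘(ℝ, F) q).symm ⁻¹' V :=
    (isOpen_preimage_extChartAt_symm hV q).mem_nhds
      ⟨mem_extChartAt_target q, by rwa [mem_preimage, hz₀, extChartAt_to_inv]⟩
  have hXd : DifferentiableAt ℝ (vecInChart X q) z₀ :=
    ((contDiffOn_chartDiff hX q).contDiffAt hVq).differentiableAt (by simp)
  have hJd : DifferentiableAt ℝ (endInChart J (ι q)) (f z₀) := by
    rw [hfz]
    exact ((contDiffOn_endInChart hJ (ι q)).contDiffAt ((isOpen_extChartAt_target _).mem_nhds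
      (mem_extChartAt_target _))).differentiableAt (by simp)
  have hXY : ∀ᶠ z in 𝓝 z₀, endInChart J (ι q) (f z) (fderiv ℝ f z (vecInChart X q z)) =
      fderiv ℝ f z (vecInChart Y q z) := by
    filter_upwards [hVq, (isOpen_chartsDomain hι.continuous q (ι q)).mem_nhds hz₀d] with z hz hzd
    have h1 := diffAt_coordFrame hι hzd (vecInChart X q z)
    rw [coordFrame_vecInChart X hz.1] at h1
    have h2 := fderiv_inCharts hι hzd (vecInChart Y q z)
    rw [coordFrame_vecInChart Y hz.1] at h2
    rw [hf_def, h2]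
    refine (endInChart_apply J hzd.2 _).trans (congrArg _ ?_)
    exact (congrArg _ h1.symm).trans (hY _ hz.2).2
  have hinj : Function.Injective (fderiv ℝ f z₀) := by
    rw [hf']
    exact hCR.immersion.2 q
  have hYd : DifferentiableAt ℝ (vecInChart Y q) z₀ := by
    refine differentiableAt_of_apply_eq ((hf2.fderiv_right (m := 1)
      (by norm_num)).differentiableAt (by simp)) ?_ hinj (hXY.mono fun z hz => hz.symm)
    exact (hJd.comp z₀ (hf2.differentiableAt (by simp))).clm_apply
      (hasFDerivAt_fderiv_apply hf2 hXd).differentiableAt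
  have hG₀ : ∀ x y, metricInChart g.inner (ι q) (f z₀) x y = bilinAt g.inner (ι q) x y := by
    rw [hfz]
    exact metricInChart_self g.inner (ι q)
  have hJ₀ : ∀ x, endInChart J (ι q) (f z₀) x = endAt J (ι q) x := by
    rw [hfz]
    exact endInChart_self J (ι q)
  have hX₀ : vecInChart X q z₀ = (show F from X q) := vecInChart_self X q
  obtain ⟨hYD, hYJ⟩ := hY q hq
  rw [mem_perp_iff] at ha
  have hb' := mem_perp_iff.1 hb
  have hgeod' := (isTotallyGeodesic_iff g ι).1 hgeod q
  have key := fderiv_dualForm (f := f) (z₀ := z₀) (G := metricInChart g.inner (ι q))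
    (J := endInChart J (ι q)) (X := vecInChart X q) (Y := vecInChart Y q)
    (Γ := christoffelAt g.inner (ι q)) (a := a) (b := b) hf2
    (by rw [hfz]; exact metricInChart_differentiableAt g _)
    (eventually_metricInChart_comm g _ _) hJd
    (fun x y => by rw [hG₀, hG₀, hJ₀, hJ₀]; exact hJ.compat _ _ _) hXd hYd hXY
    (fun x y w => by rw [hG₀, hfz]; exact bilinAt_christoffelAt g _ x y w)
    (fun x y => by rw [hf']; exact hgeod' x y)
    (fun c => by
      rw [hG₀, hJ₀, hf', bilinAt_comm]
      exact hCR.totallyReal q b hb _ ⟨c, rfl⟩)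
    (by
      rw [hG₀, hJ₀, hJ₀, hJ₀, hf', hX₀, hfz]
      refine bilinAt_covDerivEnd_eq_zero hJ hlee ?_ ?_ ?_ ?_ ?_
      · exact covectorAt_diffAt_eq_zero (hB q) _
      · exact (congrArg _ hYJ).trans (covectorAt_diffAt_eq_zero (hB q) _)
      · exact (bilinAt_comm g _ _ _).trans (hb' _ (hXD q hq))
      · exact ha _ (hXD q hq)
      · exact (congrArg _ hYJ).trans (ha _ hYD))
  rw [hG₀, hf', hX₀] at key
  exact key

end Key

end LCK

end

/-! ### Distributions and integral manifolds -/

noncomputable section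

namespace LCK

open Filter Topology

section Integrability

universe w

variable {F : Type*} [NormedAddCommGroup F] [NormedSpace ℝ F]
variable {N : Type w} [TopologicalSpace N] [ChartedSpace F N]

set_option synthInstance.maxHeartbeats 200000

theorem mem_perp_iff_of_span {E : Type*} [NormedAddCommGroup E] [NormedSpace ℝ E]
    [FiniteDimensional ℝ E] {M : Type*} [TopologicalSpace M] [ChartedSpace E M]
    [IsManifold 𝓘(ℝ, E) ∞ M] {g : Metric E M} {ι : N → M} {D : SubspaceField F N} {q : N}
    {m : ℕ} {X : Fin m → TangentSpace 𝓘(ℝ, F) q} (hX : Submodule.span ℝ (range X) = D q) {v : F} :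
    v ∈ perp g ι D q ↔
      ∀ i, bilinAt g.inner (ι q) (diffAt E F ι q (X i)) (diffAt E F ι q v) = 0 := by
  rw [mem_perp_iff]
  constructor
  · intro h i
    rw [bilinAt_comm]
    refine h _ ?_
    rw [← hX]
    exact Submodule.subset_span ⟨i, rfl⟩
  · intro h d hd
    rw [← hX] at hd
    have hle : (Submodule.span ℝ (range X) : Submodule ℝ F) ≤ LinearMap.ker
        ((bilinAt g.inner (ι q) (diffAt E F ι q v)).comp (diffAt E F ι q)).toLinearMap := by
      rw [Submodule.span_le]
      rintro _ ⟨i, rfl⟩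
      exact (bilinAt_comm g _ _ _).trans (h i)
    exact hle hd

/-- The one-forms dual to linearly independent vectors are linearly independent. -/
theorem surjective_pi_dual {E : Type*} [NormedAddCommGroup E] [NormedSpace ℝ E]
    {b : E →L[ℝ] E →L[ℝ] ℝ} (hb : ∀ v, v ≠ 0 → 0 < b v v) {A : F →L[ℝ] E}
    (hA : Function.Injective A) {m : ℕ} {X : Fin m → F} (hX : LinearIndependent ℝ X) :
    Function.Surjective
      (ContinuousLinearMap.pi fun i => (b (A (X i))).comp A : F →L[ℝ] Fin m → ℝ) := by
  set T : F →L[ℝ] Fin m → ℝ := ContinuousLinearMap.pi fun i => (b (A (X i))).comp A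
  refine (LinearMap.range_eq_top (f := T.toLinearMap)).1 ?_
  by_contra hne
  obtain ⟨l, hl, hle⟩ := Submodule.exists_le_ker_of_lt_top _ (lt_top_iff_ne_top.2 hne)
  apply hl
  have hlc : ∀ c : Fin m → ℝ, l c = ∑ i, c i * l (Pi.single i 1) := by
    intro c
    conv_lhs => rw [pi_eq_sum_univ' c]
    simp [map_sum]
  set u : F := ∑ i, l (Pi.single i 1) • X i with hu
  have h1 : l (T u) = 0 := hle ⟨u, rfl⟩
  have h2 : b (A u) (A u) = 0 := by
    have h5 : b (A u) = ∑ i, l (Pi.single i 1) • b (A (X i)) := by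
      rw [hu]
      simp only [map_sum, map_smul]
    rw [← h1, hlc, h5, sum_apply]
    exact Finset.sum_congr rfl fun i _ => mul_comm _ _
  have h3 : u = 0 := by
    by_contra hne
    exact (hb (A u) (fun h => hne (hA (h.trans (map_zero A).symm)))).ne' h2
  have h4 := Fintype.linearIndependent_iff.1 hX _ h3
  ext i
  simpa using h4 i

variable [IsManifold 𝓘(ℝ, F) ∞ N]

/-- A distribution is integrable if integral manifolds through every point, parametrized by balls,
exist in charts. -/
theorem isIntegrable_of_charts {D : SubspaceField F N}
    (h : ∀ p : N, ∃ (k : ℕ) (r : ℝ) (j : EuclideanSpace ℝ (Fin k) → F), 0 < r ∧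
      j 0 = extChartAt 𝓘(ℝ, F) p p ∧ ContDiffOn ℝ ∞ j (Metric.ball 0 r) ∧
      InjOn j (Metric.ball 0 r) ∧ ∀ x ∈ Metric.ball (0 : EuclideanSpace ℝ (Fin k)) r,
        j x ∈ (extChartAt 𝓘(ℝ, F) p).target ∧
        ∃ j' : EuclideanSpace ℝ (Fin k) →L[ℝ] F, HasFDerivAt j j' x ∧ Function.Injective j' ∧
          ∀ v, v ∈ range j' ↔ coordFrame p (j x) v ∈ D ((extChartAt 𝓘(ℝ, F) p).symm (j x))) :
    IsIntegrable D := by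
  intro p
  obtain ⟨k, r, j, hr, hj0, hjs, hji, hj⟩ := h p
  let A := EuclideanSpace ℝ (Fin k)
  let L : Type w := ULift.{w} (Metric.ball (0 : A) r)
  let e : L → A := fun x => x.down.1
  have he : Topology.IsOpenEmbedding e :=
    Metric.isOpen_ball.isOpenEmbedding_subtypeVal.comp Homeomorph.ulift.isOpenEmbedding
  have hmem : ∀ x : L, e x ∈ Metric.ball (0 : A) r := fun x => x.down.2
  let o : L := ⟨⟨0, Metric.mem_ball_self hr⟩⟩
  have : Nonempty L := ⟨o⟩
  let : ChartedSpace A L := he.singletonChartedSpace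
  have : IsManifold 𝓘(ℝ, A) ∞ L := he.isManifold_singleton
  have hes : ContMDiff 𝓘(ℝ, A) 𝓘(ℝ, A) ∞ e := contMDiff_isOpenEmbedding he
  have hed : ∀ x : L, (mfderiv 𝓘(ℝ, A) 𝓘(ℝ, A) e x : A →L[ℝ] A) = ContinuousLinearMap.id ℝ A :=
    fun x => chartDiff_self x
  set φ := extChartAt 𝓘(ℝ, F) p
  have hjm : ContMDiff 𝓘(ℝ, A) 𝓘(ℝ, F) ∞ (fun x : L => j (e x)) :=
    ContMDiffOn.comp_contMDiff (contMDiffOn_iff_contDiffOn.2 hjs) hes hmem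
  have hJm : ContMDiff 𝓘(ℝ, A) 𝓘(ℝ, F) ∞ (fun x : L => φ.symm (j (e x))) :=
    (contMDiffOn_extChartAt_symm p).comp_contMDiff hjm fun x => (hj _ (hmem x)).1
  have hd : ∀ x : L, ∀ j' : A →L[ℝ] F, HasFDerivAt j j' (e x) → ∀ s : A,
      diffAt F A (fun x : L => φ.symm (j (e x))) x s = coordFrame p (j (e x)) (j' s) := by
    intro x j' hj' s
    have h1 : MDifferentiableAt 𝓘(ℝ, A) 𝓘(ℝ, A) e x := hes.contMDiffAt.mdifferentiableAt (by simp)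
    have h2 : MDifferentiableAt 𝓘(ℝ, A) 𝓘(ℝ, F) j (e x) :=
      hj'.differentiableAt.mdifferentiableAt
    have h3 : MDifferentiableAt 𝓘(ℝ, F) 𝓘(ℝ, F) φ.symm (j (e x)) :=
      ((contMDiffOn_extChartAt_symm (I := 𝓘(ℝ, F)) (n := ∞) p).contMDiffAt
        ((isOpen_extChartAt_target p).mem_nhds (hj _ (hmem x)).1)).mdifferentiableAt (by simp)
    have h4 := mfderiv_comp x h3 (h2.comp x h1)
    rw [mfderiv_comp x h2 h1, mfderiv_eq_fderiv, hj'.fderiv] at h4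
    refine (DFunLike.congr_fun h4 s).trans ?_
    have h5 : (mfderiv 𝓘(ℝ, A) 𝓘(ℝ, A) e x : A →L[ℝ] A) s = s := by
      rw [hed x]
      rfl
    exact congrArg (fun s => coordFrame p (j (e x)) (j' s)) h5
  have hcinj : ∀ x : L, Function.Injective (coordFrame p (j (e x))) := fun x =>
    Function.LeftInverse.injective (chartDiff_coordFrame (hj _ (hmem x)).1)
  refine ⟨k, L, inferInstance, inferInstance, inferInstance, fun x => φ.symm (j (e x)),
    ⟨?_, ⟨hJm, ?_⟩, ?_⟩, o, ?_⟩
  · intro x y hxy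
    exact he.injective (hji (hmem x) (hmem y)
      (φ.symm.injOn (hj _ (hmem x)).1 (hj _ (hmem y)).1 hxy))
  · intro x s t hst
    obtain ⟨-, j', hj', hinj, -⟩ := hj _ (hmem x)
    apply hinj
    apply hcinj x
    exact (hd x j' hj' s).symm.trans (hst.trans (hd x j' hj' t))
  · intro x
    obtain ⟨hjt, j', hj', -, hrange⟩ := hj _ (hmem x)
    ext1 v
    refine (mem_tangentImage_iff (E := F) (F := A)).trans ?_
    have h1 : coordFrame p (j (e x)) (chartDiff p (φ.symm (j (e x))) v) = v :=
      coordFrame_chartDiff hjt v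
    have h2 := hrange (chartDiff p (φ.symm (j (e x))) v)
    rw [h1] at h2
    refine Iff.trans ?_ h2
    constructor
    · rintro ⟨s, rfl⟩
      refine ⟨s, ?_⟩
      rw [hd x j' hj']
      exact (chartDiff_coordFrame hjt _).symm
    · rintro ⟨s, hs⟩
      refine ⟨s, ?_⟩
      rw [hd x j' hj', hs]
      exact h1.symm
  · change φ.symm (j 0) = p
    rw [hj0]
    exact extChartAt_to_inv p

end Integrability

end LCK

end

/-! ### Independence of the chart -/

noncomputable section

namespace LCK

open Filter Topology

section Ruled

variable {E : Type*} [NormedAddCommGroup E] [NormedSpace ℝ E]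
variable {M : Type*} [TopologicalSpace M] [ChartedSpace E M] [IsManifold 𝓘(ℝ, E) ∞ M]
variable {F : Type*} [NormedAddCommGroup F] [NormedSpace ℝ F]
variable {N : Type*} [TopologicalSpace N] [ChartedSpace F N] [IsManifold 𝓘(ℝ, F) ∞ N]

set_option synthInstance.maxHeartbeats 200000

theorem chartDualForm_apply' (g : BilinField E M) {ι : N → M}
    (hι : ContMDiff 𝓘(ℝ, F) 𝓘(ℝ, E) ∞ ι) (X : ∀ q : N, TangentSpace 𝓘(ℝ, F) q) {q x : N}
    (hx : x ∈ (extChartAt 𝓘(ℝ, F) q).source) (hιx : ι x ∈ (extChartAt 𝓘(ℝ, E) (ι q)).source)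
    (v : F) :
    chartDualForm g ι X q (extChartAt 𝓘(ℝ, F) q x) v = bilinAt g (ι x)
      (diffAt E F ι x (X x)) (diffAt E F ι x (coordFrame q (extChartAt 𝓘(ℝ, F) q x) v)) := by
  have h := chartDualForm_apply g hι X (mem_chartsDomain hx hιx) v
  rwa [(extChartAt 𝓘(ℝ, F) q).left_inv hx] at h

/-- The exterior derivative of the one-form dual to `X` does not depend on the chart. -/
theorem fderiv_chartDualForm_sub [FiniteDimensional ℝ E] (g : Metric E M) {ι : N → M}
    (hι : ContMDiff 𝓘(ℝ, F) 𝓘(ℝ, E) ∞ ι) {X : ∀ q : N, TangentSpace 𝓘(ℝ, F) q} {V : Set N}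
    (hV : IsOpen V) (hX : ContMDiffOn 𝓘(ℝ, F) 𝓘(ℝ, F).tangent ∞
      (fun q => (⟨q, X q⟩ : TangentBundle 𝓘(ℝ, F) N)) V) {q : N} {z : F}
    (hz : z ∈ chartsDomain E F ι q (ι q)) {x : N} (hx : (extChartAt 𝓘(ℝ, F) q).symm z = x)
    (hxV : x ∈ V) (v w : F) :
    fderiv ℝ (chartDualForm g.inner ι X q) z v w - fderiv ℝ (chartDualForm g.inner ι X q) z w v =
      fderiv ℝ (chartDualForm g.inner ι X x) (extChartAt 𝓘(ℝ, F) x x)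
        (coordFrame q z v) (coordFrame q z w) -
      fderiv ℝ (chartDualForm g.inner ι X x) (extChartAt 𝓘(ℝ, F) x x)
        (coordFrame q z w) (coordFrame q z v) := by
  -- the change of charts
  set ψ := inCharts (E := F) (F := F) (id : N → N) q x with hψ_def
  have hid : ContMDiff 𝓘(ℝ, F) 𝓘(ℝ, F) ∞ (id : N → N) := contMDiff_id
  have hzψ : z ∈ chartsDomain F F (id : N → N) q x :=
    ⟨hz.1, by
      rw [mem_preimage, hx]
      exact mem_extChartAt_source x⟩
  have hψ : ContDiffAt ℝ ∞ ψ z := contDiffAt_inCharts hid hzψ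
  have hψ2 : ContDiffAt ℝ 2 ψ z := contDiffAt_infty.1 hψ 2
  have hψz : ψ z = extChartAt 𝓘(ℝ, F) x x := by rw [hψ_def, inCharts, hx, id]
  have hdid : ∀ (y : N) (u : F), diffAt F F (id : N → N) y u = u := fun y u =>
    DFunLike.congr_fun (mfderiv_id (I := 𝓘(ℝ, F)) (x := y)) u
  have hψ' : ∀ u, fderiv ℝ ψ z u = coordFrame q z u := by
    intro u
    refine (fderiv_inCharts hid hzψ u).trans ?_
    have h1 : ∀ y, y = x → chartDiff x y (diffAt F F (id : N → N) y (coordFrame q z u)) =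
        coordFrame q z u := by
      rintro _ rfl
      rw [hdid, chartDiff_self]
      rfl
    exact h1 _ hx
  have hxd : extChartAt 𝓘(ℝ, F) x x ∈ chartsDomain E F ι x (ι x) :=
    mem_chartsDomain (mem_extChartAt_source x) (mem_extChartAt_source _)
  have hT : DifferentiableAt ℝ (chartDualForm g.inner ι X x) (ψ z) := by
    rw [hψz]
    refine ((contDiffOn_chartDualForm g hι hX x).contDiffAt (IsOpen.mem_nhds
      ((isOpen_chartsDomain hι.continuous x (ι x)).inter (isOpen_preimage_extChartAt_symm hV x))
      ⟨hxd, hxd.1, ?_⟩)).differentiableAt (by simp)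
    rwa [mem_preimage, extChartAt_to_inv]
  have hpull : chartDualForm g.inner ι X q =ᶠ[𝓝 z]
      fun y => (chartDualForm g.inner ι X x (ψ y)).comp (fderiv ℝ ψ y) := by
    have h1 : ∀ᶠ y in 𝓝 z, (extChartAt 𝓘(ℝ, F) q).symm y ∈
        ι ⁻¹' (extChartAt 𝓘(ℝ, E) (ι x)).source :=
      ((continuousAt_extChartAt_symm'' hz.1).eventually_mem
        (((isOpen_extChartAt_source (ι x)).preimage hι.continuous).mem_nhds (by
          rw [hx]
          exact mem_extChartAt_source (ι x))))
    filter_upwards [(isOpen_chartsDomain hι.continuous q (ι q)).mem_nhds hz,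
      (isOpen_chartsDomain hid.continuous q x).mem_nhds hzψ, h1] with y hy hyψ hyx
    ext1 u
    rw [chartDualForm_apply g.inner hι X hy u]
    refine Eq.trans ?_ (chartDualForm_apply' g.inner hι X hyψ.2 hyx _).symm
    have h2 := diffAt_coordFrame hid hyψ u
    rw [hdid] at h2
    rw [h2]
    rfl
  have hsymm : fderiv ℝ (fderiv ℝ ψ) z v w = fderiv ℝ (fderiv ℝ ψ) z w v :=
    (hψ2.isSymmSndFDerivAt (by simp)) v w
  rw [fderiv_pullback hT hψ2 hpull, fderiv_pullback hT hψ2 hpull, hsymm, hψz, hψ', hψ']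
  ring

end Ruled

end LCK

end

/-! ### The totally real foliation -/

noncomputable section

namespace LCK

open Filter Topology

section TotallyReal

universe w

variable {E : Type*} [NormedAddCommGroup E] [NormedSpace ℝ E] [FiniteDimensional ℝ E]
variable {M : Type*} [TopologicalSpace M] [ChartedSpace E M] [IsManifold 𝓘(ℝ, E) ∞ M]
variable {F : Type*} [NormedAddCommGroup F] [NormedSpace ℝ F]
variable {N : Type w} [TopologicalSpace N] [ChartedSpace F N] [IsManifold 𝓘(ℝ, F) ∞ N]

set_option synthInstance.maxHeartbeats 200000

/-- The second covariant derivative of a map is symmetric: the Levi-Civita connection has no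
torsion. -/
theorem bilinAt_secondDerivAt_comm (g : Metric E M) {ι : N → M}
    (hι : ContMDiff 𝓘(ℝ, F) 𝓘(ℝ, E) ∞ ι) (q : N) (x : E) (a b : F) :
    bilinAt g.inner (ι q) x (secondDerivAt F g.inner ι q a b) =
      bilinAt g.inner (ι q) x (secondDerivAt F g.inner ι q b a) := by
  have hf : ContDiffAt ℝ 2 (inCharts (E := E) (F := F) ι q (ι q)) (extChartAt 𝓘(ℝ, F) q q) :=
    contDiffAt_infty.1 (contDiffAt_inCharts hι
      (mem_chartsDomain (mem_extChartAt_source q) (mem_extChartAt_source _))) 2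
  rw [secondDerivAt, secondDerivAt, (hf.isSymmSndFDerivAt (by simp)) a b, map_add, map_add,
    bilinAt_comm g _ x (christoffelAt _ _ _ _), bilinAt_comm g _ x (christoffelAt _ _ _ _),
    bilinAt_christoffelAt, bilinAt_christoffelAt,
    christoffelForm_comm (metricInChart_differentiableAt g _)
      (eventually_metricInChart_comm g _ _)]

variable [FiniteDimensional ℝ F]
variable {g : Metric E M} {J : EndField E M} {lee : OneForm E M} {ι : N → M}
  {D : SubspaceField F N}

/-- The totally real distribution of a totally geodesic CR-submanifold with normal Lee field is
integrable: by `fderiv_chartDualForm` the one-forms dual to a frame of the holomorphic distribution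
have exterior derivatives that vanish on the totally real distribution. -/
theorem isIntegrable_perp (hJ : IsAlmostHermitian g J) (hlee : IsLeeForm g J lee)
    (hCR : IsCRSubmanifold g J ι D)
    (hB : ∀ q, leeField g lee (ι q) ∈ orthogonal g (ι q) (tangentImage (F := F) ι q))
    (hgeod : IsTotallyGeodesic (F := F) g ι) : IsIntegrable (perp g ι D) := by
  have hι := hCR.immersion.1
  refine isIntegrable_of_charts fun p => ?_
  obtain ⟨V, hV, hpV, m, X, hX, hXD⟩ := hCR.smooth p
  have hXmem : ∀ i, ∀ q ∈ V, X i q ∈ D q := fun i q hq => by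
    rw [← (hXD q hq).2]
    exact Submodule.subset_span ⟨i, rfl⟩
  set z₀ := extChartAt 𝓘(ℝ, F) p p with hz₀
  set W := chartsDomain E F ι p (ι p) ∩
    ((extChartAt 𝓘(ℝ, F) p).target ∩ (extChartAt 𝓘(ℝ, F) p).symm ⁻¹' V)
  have hW : IsOpen W := (isOpen_chartsDomain hι.continuous p (ι p)).inter
    (isOpen_preimage_extChartAt_symm hV p)
  have hz₀d : z₀ ∈ chartsDomain E F ι p (ι p) :=
    mem_chartsDomain (mem_extChartAt_source p) (mem_extChartAt_source _)
  have hz₀W : z₀ ∈ W := ⟨hz₀d, hz₀d.1, by rwa [mem_preimage, hz₀, extChartAt_to_inv]⟩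
  set T : F → F →L[ℝ] Fin m → ℝ := fun z =>
    ContinuousLinearMap.pi fun i => chartDualForm g.inner ι (X i) p z
  have hTi : ∀ i, ContDiffOn ℝ ∞ (chartDualForm g.inner ι (X i) p) W := fun i =>
    contDiffOn_chartDualForm g hι (hX i) p
  have hT : ContDiffOn ℝ ∞ T W := by
    rw [contDiffOn_clm_apply]
    intro v
    rw [contDiffOn_pi]
    intro i
    exact (hTi i).clm_apply contDiffOn_const
  have hker : ∀ z ∈ W, ∀ v, T z v = 0 ↔
      coordFrame p z v ∈ perp g ι D ((extChartAt 𝓘(ℝ, F) p).symm z) := by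
    intro z hz v
    refine Iff.trans ?_ (mem_perp_iff_of_span (hXD _ hz.2.2).2).symm
    rw [funext_iff]
    refine forall_congr' fun i => ?_
    have h1 := chartDualForm_apply g.inner hι (X i) hz.1 v
    rw [← h1]
    rfl
  have hsurj : Function.Surjective (T z₀) := by
    have h1 := surjective_pi_dual (bilinAt_pos g (ι p)) (A := diffAt E F ι p)
      (hCR.immersion.2 p) (X := fun i => X i p) (hXD p hpV).1
    convert h1 using 2
    ext v i
    have h2 := chartDualForm_apply' g.inner hι (X i) (mem_extChartAt_source p)
      (mem_extChartAt_source (I := 𝓘(ℝ, E)) (ι p)) v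
    rw [coordFrame_self] at h2
    exact h2
  have hint : ∀ z ∈ W, ∀ v w : F, T z v = 0 → T z w = 0 →
      fderiv ℝ T z v w = fderiv ℝ T z w v := by
    intro z hz v w hv hw
    rw [hker z hz] at hv hw
    have hTd : HasFDerivAt T (fderiv ℝ T z) z :=
      ((hT.contDiffAt (hW.mem_nhds hz)).differentiableAt (by simp)).hasFDerivAt
    have hcomp : ∀ i v w, fderiv ℝ T z v w i =
        fderiv ℝ (chartDualForm g.inner ι (X i) p) z v w := by
      intro i v w
      have h1 : HasFDerivAt (fun y => (ContinuousLinearMap.proj (R := ℝ)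
          (φ := fun _ : Fin m => ℝ) i).comp (T y)) _ z :=
        (hasFDerivAt_const _ z).clm_comp hTd
      have h2 : (fun y => (ContinuousLinearMap.proj (R := ℝ)
          (φ := fun _ : Fin m => ℝ) i).comp (T y)) = chartDualForm g.inner ι (X i) p := rfl
      rw [h2] at h1
      rw [h1.fderiv]
      simp
    ext i
    rw [hcomp, hcomp, ← sub_eq_zero, fderiv_chartDualForm_sub g hι hV (hX i) hz.1 rfl hz.2.2,
      fderiv_chartDualForm hJ hlee hCR hB hgeod hV (hX i) (hXmem i) hz.2.2 hv hw,
      fderiv_chartDualForm hJ hlee hCR hB hgeod hV (hX i) (hXmem i) hz.2.2 hw hv,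
      bilinAt_secondDerivAt_comm g hι, sub_self]
  obtain ⟨k, r, j, hr, hj0, hjs, hji, hj⟩ := exists_integral_of_ker hW hz₀W hT hsurj hint
  refine ⟨k, r, j, hr, hj0, hjs, hji, fun x hx => ?_⟩
  obtain ⟨hjW, j', hj', hinj, hrange⟩ := hj x hx
  exact ⟨hjW.1.1, j', hj', hinj, fun v => (hrange v).trans (hker _ hjW v)⟩

/-- The integral manifolds of the totally real distribution of a totally geodesic CR-submanifold
with normal Lee field are totally geodesic in the ambient manifold: the derivative of a one-form
that vanishes along the integral manifold gives, by `fderiv_chartDualForm`, that its second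
covariant derivative is orthogonal to the holomorphic distribution. -/
theorem isTotallyGeodesic_comp (hJ : IsAlmostHermitian g J) (hlee : IsLeeForm g J lee)
    (hCR : IsCRSubmanifold g J ι D)
    (hB : ∀ q, leeField g lee (ι q) ∈ orthogonal g (ι q) (tangentImage (F := F) ι q))
    (hgeod : IsTotallyGeodesic (F := F) g ι) {k : ℕ} {L : Type*} [TopologicalSpace L]
    [ChartedSpace (EuclideanSpace ℝ (Fin k)) L]
    [IsManifold 𝓘(ℝ, EuclideanSpace ℝ (Fin k)) ∞ L] {j : L → N}
    (hj : IsIntegralManifold (k := k) (perp g ι D) j) :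
    IsTotallyGeodesic (F := EuclideanSpace ℝ (Fin k)) g (ι ∘ j) := by
  have hι := hCR.immersion.1
  obtain ⟨-, ⟨hjm, -⟩, htan⟩ := hj
  rw [isTotallyGeodesic_iff]
  intro x s t
  let A := EuclideanSpace ℝ (Fin k)
  change ∃ c : A, secondDerivAt A g.inner (ι ∘ j) x s t = diffAt E A (ι ∘ j) x c
  set x₀ := extChartAt 𝓘(ℝ, A) x x with hx₀
  set f := inCharts (E := E) (F := F) ι (j x) (ι (j x)) with hf_def
  set i := inCharts (E := F) (F := A) j x (j x) with hi_def
  set h := inCharts (E := E) (F := A) (ι ∘ j) x (ι (j x)) with hh_def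
  have hιj : ContMDiff 𝓘(ℝ, A) 𝓘(ℝ, E) ∞ (ι ∘ j) := hι.comp hjm
  have hx₀i : x₀ ∈ chartsDomain F A j x (j x) :=
    mem_chartsDomain (mem_extChartAt_source x) (mem_extChartAt_source _)
  have hix : i x₀ = extChartAt 𝓘(ℝ, F) (j x) (j x) := inCharts_self j x (j x)
  have hxd : i x₀ ∈ chartsDomain E F ι (j x) (ι (j x)) := by
    rw [hix]
    exact mem_chartsDomain (mem_extChartAt_source _) (mem_extChartAt_source _)
  have hf2 : ContDiffAt ℝ 2 f (i x₀) := contDiffAt_infty.1 (contDiffAt_inCharts hι hxd) 2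
  have hi2 : ContDiffAt ℝ 2 i x₀ := contDiffAt_infty.1 (contDiffAt_inCharts hjm hx₀i) 2
  have hdf : fderiv ℝ f (i x₀) = diffAt E F ι (j x) := by
    rw [hix]
    exact fderiv_inCharts_eq_diffAt hι (j x)
  have hdi : fderiv ℝ i x₀ = diffAt F A j x := fderiv_inCharts_eq_diffAt hjm x
  have hcomp : ∀ y c, diffAt E A (ι ∘ j) y c = diffAt E F ι (j y) (diffAt F A j y c) := by
    intro y c
    exact DFunLike.congr_fun (mfderiv_comp y (hι.contMDiffAt.mdifferentiableAt (by simp))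
      (hjm.contMDiffAt.mdifferentiableAt (by simp))) c
  have hnear : ∀ᶠ y in 𝓝 x₀, y ∈ chartsDomain F A j x (j x) :=
    (isOpen_chartsDomain hjm.continuous x (j x)).mem_nhds hx₀i
  have hfi : h =ᶠ[𝓝 x₀] fun y => f (i y) := by
    filter_upwards [hnear] with y hy
    simp only [hh_def, hf_def, hi_def, inCharts]
    rw [(extChartAt 𝓘(ℝ, F) (j x)).left_inv hy.2]
    rfl
  -- the second covariant derivatives of `ι ∘ j` and `ι`
  have hsecond : secondDerivAt A g.inner (ι ∘ j) x s t =
      secondDerivAt F g.inner ι (j x) (diffAt F A j x s) (diffAt F A j x t) +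
        diffAt E F ι (j x) (fderiv ℝ (fderiv ℝ i) x₀ s t) := by
    have h1 := fderiv_fderiv_comp hf2 hi2 hfi s t
    rw [hdf, hdi] at h1
    have h2 : secondDerivAt A g.inner (ι ∘ j) x s t = fderiv ℝ (fderiv ℝ h) x₀ s t +
      christoffelAt g.inner (ι (j x)) (diffAt E A (ι ∘ j) x s) (diffAt E A (ι ∘ j) x t) := rfl
    rw [h2, h1, hcomp, hcomp, secondDerivAt, hix]
    abel
  have htan' : ∀ y v, v ∈ perp g ι D (j y) ↔ ∃ c, v = diffAt F A j y c := by
    intro y v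
    rw [← htan y]
    exact mem_tangentImage_iff (E := F) (F := A)
  obtain ⟨V, hV, hxV, m, X, hX, hXD⟩ := hCR.smooth (j x)
  obtain ⟨c, hc⟩ := (isTotallyGeodesic_iff g ι).1 hgeod (j x) (diffAt F A j x s) (diffAt F A j x t)
  set η : F := c + fderiv ℝ (fderiv ℝ i) x₀ s t
  have hη : secondDerivAt A g.inner (ι ∘ j) x s t = diffAt E F ι (j x) η := by
    rw [hsecond, hc, map_add]
  have hηperp : η ∈ perp g ι D (j x) := by
    rw [mem_perp_iff_of_span (hXD _ hxV).2]
    intro l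
    rw [← hη, hsecond]
    set T := chartDualForm g.inner ι (X l) (j x)
    have hXmem : ∀ q ∈ V, X l q ∈ D q := fun q hq => by
      rw [← (hXD q hq).2]
      exact Submodule.subset_span ⟨l, rfl⟩
    have hTd : DifferentiableAt ℝ T (i x₀) := by
      refine ((contDiffOn_chartDualForm g hι (hX l) (j x)).contDiffAt (IsOpen.mem_nhds
        ((isOpen_chartsDomain hι.continuous _ _).inter (isOpen_preimage_extChartAt_symm hV _))
        ⟨hxd, hxd.1, ?_⟩)).differentiableAt (by simp)
      rwa [mem_preimage, hix, extChartAt_to_inv]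
    -- the pull-back of the one-form to the integral manifold vanishes
    have hzero : (fun _ => 0 : A → A →L[ℝ] ℝ) =ᶠ[𝓝 x₀]
        fun y => (T (i y)).comp (fderiv ℝ i y) := by
      have hVnear : ∀ᶠ y in 𝓝 x₀, i y ∈ chartsDomain E F ι (j x) (ι (j x)) ∩
          ((extChartAt 𝓘(ℝ, F) (j x)).target ∩ (extChartAt 𝓘(ℝ, F) (j x)).symm ⁻¹' V) := by
        refine hi2.continuousAt.eventually_mem (IsOpen.mem_nhds
          ((isOpen_chartsDomain hι.continuous _ _).inter (isOpen_preimage_extChartAt_symm hV _))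
          ⟨hxd, hxd.1, ?_⟩)
        rwa [mem_preimage, hix, extChartAt_to_inv]
      filter_upwards [hnear, hVnear] with y hy hyV
      ext1 u
      have hjy : (extChartAt 𝓘(ℝ, F) (j x)).symm (i y) = j ((extChartAt 𝓘(ℝ, A) x).symm y) :=
        (extChartAt 𝓘(ℝ, F) (j x)).left_inv hy.2
      have h1 := diffAt_coordFrame hjm hy u
      have h2 := hyV.1.2
      have h3 := hyV.2.2
      rw [mem_preimage, hjy] at h2 h3
      have h4 := chartDualForm_apply' g.inner hι (X l) hy.2 h2 (fderiv ℝ i y u)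
      refine Eq.trans ?_ h4.symm
      have h5 : coordFrame (j x) (i y) (fderiv ℝ i y u) ∈
          perp g ι D (j ((extChartAt 𝓘(ℝ, A) x).symm y)) := (htan' _ _).2 ⟨_, h1.symm⟩
      exact ((mem_perp_iff_of_span (hXD _ h3).2).1 h5 l).symm
    have h1 := fderiv_pullback hTd hi2 hzero s t
    rw [fderiv_fun_const, hdi, hix] at h1
    have h2 := fderiv_chartDualForm hJ hlee hCR hB hgeod hV (hX l) hXmem hxV
      ((htan' x _).2 ⟨s, rfl⟩) ((htan' x _).2 ⟨t, rfl⟩)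
    have h3 := chartDualForm_apply' g.inner hι (X l) (mem_extChartAt_source (j x))
      (mem_extChartAt_source (I := 𝓘(ℝ, E)) (ι (j x))) (fderiv ℝ (fderiv ℝ i) x₀ s t)
    rw [coordFrame_self] at h3
    rw [map_add, ← h2]
    refine Eq.trans ?_ h1.symm
    exact congrArg _ h3.symm
  obtain ⟨e, he⟩ := (htan' x η).1 hηperp
  exact ⟨e, by rw [hη, he, hcomp]⟩

end TotallyReal

end LCK

end

theorem mainTheorem9
    {E : Type*} [NormedAddCommGroup E] [NormedSpace ℝ E] [FiniteDimensional ℝ E]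
    {Mbar : Type*} [TopologicalSpace Mbar] [ChartedSpace E Mbar] [IsManifold 𝓘(ℝ, E) ∞ Mbar]
    {F : Type*} [NormedAddCommGroup F] [NormedSpace ℝ F] [FiniteDimensional ℝ F]
    {M : Type*} [TopologicalSpace M] [ChartedSpace F M] [IsManifold 𝓘(ℝ, F) ∞ M]
    (g : LCK.Metric E Mbar) (J : LCK.EndField E Mbar) (lee : LCK.OneForm E Mbar)
    (hlck : LCK.IsLocallyConformalKahler g J) (hlee : LCK.IsLeeForm g J lee)
    (ι : M → Mbar) (D : LCK.SubspaceField F M) (hCR : LCK.IsCRSubmanifold g J ι D)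
    (hB : ∀ q : M, LCK.leeField g lee (ι q) ∈
      LCK.orthogonal g (ι q) (LCK.tangentImage (F := F) ι q))
    (hgeod : LCK.IsTotallyGeodesic (F := F) g ι) :
    LCK.IsTotallyRealRuled g J ι D :=
  ⟨hCR, LCK.isIntegrable_perp hlck.1 hlee hCR hB hgeod,
    fun _ _ _ _ _ _ hj => LCK.isTotallyGeodesic_comp hlck.1 hlee hCR hB hgeod hj⟩
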